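/- In the fault-tolerant approximate minimum selection problem $\mathrm{FT\text{-}Min}(k)$, the input consists of $n$ elements with an unknown strict total order, and the task is to return one of the $k$ smallest elements. The order can only be accessed through unreliable comparisons of pairs of elements: each comparison reports the wrong result with a probability of at most a fixed constant $p<\tfrac12$, independently of all the other comparisons, including earlier comparisons of the same pair. Algorithms are randomized programs of a random access machine, in which an addition or subtraction of natural numbers, a memory access, a test, a comparison of two elements, and the choice of a uniformly random element of $\{0,\dots,v-1\}$ for a stored number $v$ take one unit of time each. Theorem. For every constant $p\in[0,\tfrac12)$ there are a single algorithm, which is given $n$ and $k$, and a constant $C$ such that for all integers $n\ge 2$ and $1\le k\le n$, for every order of the $n$ elements, and for all fault probabilities of at most $p$ of the individual comparisons, the algorithm returns one of the $k$ smallest elements with probability at least $1-\frac1n$, and its expected running time is at most $$C\cdot\Big(\frac nk\log n+(\log n)\cdot\max\{0,\log\log\log n\}\Big).$$ Here $\log$ is the logarithm to base two, and $\max\{0,\log\log\log n\}$ is read as $0$ for $n=2$. -/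

import Mathlib

open scoped ENNReal

noncomputable section

namespace FTMin

/-- Programs of a randomized random access machine with unreliable comparisons.
A program uses natural-number registers, indexed by `r s t`, and natural-number arrays, of which it
names finitely many, indexed by `a`.  The only arithmetic is addition and truncated subtraction. -/
inductive Prog : Type
  /-- do nothing -/
  | skip
  /-- register `r` := the constant `c` -/
  | const (r c : ℕ)
  /-- register `r` := register `s` + register `t` -/
  | add (r s t : ℕ)
  /-- register `r` := register `s` - register `t`, and `0` if this is negative -/
  | sub (r s t : ℕ)
  /-- register `r` := the cell of array `a` whose address is in register `s` -/
  | load (r a s : ℕ)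
  /-- the cell of array `a` whose address is in register `s` := register `r` -/
  | store (a s r : ℕ)
  /-- register `r` := a fresh uniformly random element of `{0, …, v - 1}`, where `v` is the content
  of register `s` (and `0` if `v = 0`) -/
  | rand (r s : ℕ)
  /-- compare the input elements whose indices are in the registers `s` and `t`; register `r` := `1`
  if the (unreliable) answer is "the first is smaller than the second", and `0` otherwise -/
  | cmp (r s t : ℕ)
  /-- run `P`, then `Q` -/
  | seq (P Q : Prog)
  /-- if register `r` < register `s` run `P`, otherwise run `Q` -/
  | ifLt (r s : ℕ) (P Q : Prog)
  /-- while register `r` < register `s` run `P` -/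
  | whileLt (r s : ℕ) (P : Prog)

/-- The memory of the machine, and the number of comparisons made so far.  The program cannot read
the latter: it only serves to tell the comparisons of a run apart. -/
structure State : Type where
  reg : ℕ → ℕ
  arr : ℕ → ℕ → ℕ
  cmps : ℕ

/-- Assign the value `v` to register `r`. -/
def State.setReg (σ : State) (r v : ℕ) : State :=
  { σ with reg := Function.update σ.reg r v }

/-- Assign the value `v` to cell `i` of array `a`. -/
def State.setArr (σ : State) (a i v : ℕ) : State :=
  { σ with arr := Function.update σ.arr a (Function.update (σ.arr a) i v) }

/-- A configuration: the stack of programs that remain to be run, and the memory.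
The machine has halted when the stack is empty. -/
structure Config : Type where
  todo : List Prog
  state : State

/-- A comparison fault: `true` with probability `e`, `false` with probability `1 - e`. -/
def fault (e : unitInterval) : PMF Bool :=
  PMF.ofFintype (fun b => ENNReal.ofReal (if b then (e : ℝ) else 1 - (e : ℝ))) (by
    rw [Fintype.sum_bool, if_pos rfl, if_neg Bool.false_ne_true,
      ← ENNReal.ofReal_add e.2.1 (sub_nonneg.2 e.2.2), add_sub_cancel, ENNReal.ofReal_one])

/-- The uniform distribution on `{0, …, v - 1}`, and the point mass at `0` if `v = 0`. -/
def uniformBelow : ℕ → PMF ℕ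
  | 0 => PMF.pure 0
  | v + 1 => (PMF.uniformOfFintype (Fin (v + 1))).map Fin.val

section Machine

variable {n : ℕ} (rank : Equiv.Perm (Fin n)) (err : ℕ → Fin n → Fin n → unitInterval)

/-- The effect of the instruction `Prog.cmp r s t`.  The answer is the truth value of
"element `i` is smaller than element `j`", negated if a fault occurs; the `m`-th comparison of a run,
if it is between `i` and `j`, is faulty with probability `err m i j`, independently of the past.
If one of the two registers does not hold the index of an element then the answer is `0`. -/
def compareStep (σ : State) (r s t : ℕ) : PMF State :=
  if h : σ.reg s < n ∧ σ.reg t < n then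
    (fault (err σ.cmps ⟨σ.reg s, h.1⟩ ⟨σ.reg t, h.2⟩)).map fun b =>
      { σ.setReg r
          (if xor b (decide (rank ⟨σ.reg s, h.1⟩ < rank ⟨σ.reg t, h.2⟩)) then 1 else 0) with
        cmps := σ.cmps + 1 }
  else
    PMF.pure (σ.setReg r 0)

/-- One step of the machine: the law of the next configuration.  Every instruction and every
evaluation of the condition of a conditional or of a loop takes one step, and so does the unfolding
of a `Prog.seq`.  A configuration that has halted does not change any more. -/
def step : Config → PMF Config
  | ⟨[], σ⟩ => PMF.pure ⟨[], σ⟩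
  | ⟨Prog.skip :: K, σ⟩ => PMF.pure ⟨K, σ⟩
  | ⟨Prog.const r c :: K, σ⟩ => PMF.pure ⟨K, σ.setReg r c⟩
  | ⟨Prog.add r s t :: K, σ⟩ => PMF.pure ⟨K, σ.setReg r (σ.reg s + σ.reg t)⟩
  | ⟨Prog.sub r s t :: K, σ⟩ => PMF.pure ⟨K, σ.setReg r (σ.reg s - σ.reg t)⟩
  | ⟨Prog.load r a s :: K, σ⟩ => PMF.pure ⟨K, σ.setReg r (σ.arr a (σ.reg s))⟩
  | ⟨Prog.store a s r :: K, σ⟩ => PMF.pure ⟨K, σ.setArr a (σ.reg s) (σ.reg r)⟩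
  | ⟨Prog.rand r s :: K, σ⟩ => (uniformBelow (σ.reg s)).map fun v => ⟨K, σ.setReg r v⟩
  | ⟨Prog.cmp r s t :: K, σ⟩ => (compareStep rank err σ r s t).map fun σ' => ⟨K, σ'⟩
  | ⟨Prog.seq P Q :: K, σ⟩ => PMF.pure ⟨P :: Q :: K, σ⟩
  | ⟨Prog.ifLt r s P Q :: K, σ⟩ =>
      PMF.pure ⟨(if σ.reg r < σ.reg s then P else Q) :: K, σ⟩
  | ⟨Prog.whileLt r s P :: K, σ⟩ =>
      PMF.pure ⟨if σ.reg r < σ.reg s then P :: Prog.whileLt r s P :: K else K, σ⟩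

/-- The law of the configuration that is reached from `c` after a given number of steps. -/
def run (c : Config) : ℕ → PMF Config
  | 0 => PMF.pure c
  | t + 1 => (run c t).bind (step rank err)

/-- The initial configuration of the program `A` on an instance with `n` elements and parameter `k`:
register `0` holds `n`, register `1` holds `k`, and everything else is `0`. -/
def init (A : Prog) (n k : ℕ) : Config where
  todo := [A]
  state :=
    { reg := fun r => if r = 0 then n else if r = 1 then k else 0
      arr := fun _ _ => 0
      cmps := 0 }

/-- The configuration has halted, and register `0` holds the index of one of the `k` smallest
elements. -/
def IsSolution (k : ℕ) (c : Config) : Prop :=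
  c.todo = [] ∧ ∃ i : Fin n, c.state.reg 0 = i ∧ (rank i : ℕ) < k

/-- The probability that `A` halts and returns one of the `k` smallest elements (the limit, as `t`
grows, of the probability that it has done so within `t` steps). -/
def successProb (A : Prog) (k : ℕ) : ℝ≥0∞ :=
  ⨆ t : ℕ, (run rank err (init A n k) t).toOuterMeasure {c | IsSolution rank k c}

/-- The expectation of the running time `T ∈ ℕ ∪ {∞}` of `A`, that is of the number of steps until
it halts, as the sum over `t` of the probabilities of `T > t`. -/
def expectedTime (A : Prog) (k : ℕ) : ℝ≥0∞ :=
  ∑' t : ℕ, (run rank err (init A n k) t).toOuterMeasure {c | c.todo ≠ []}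

end Machine

end FTMin

end

/-!
An element is found by a tournament of random challengers against a champion `x`.  A trial draws a
random challenger `y` and lets it fight a duel with `x`: a random walk that starts at a constant
height `a` and moves up or down according to the answers to the question whether `y < x`, and that
`y` wins if it reaches the height `H` before `0`.  A geometric supermartingale shows that a smaller
challenger wins with probability at least `1 / 2` (`ert_duel_of_lt`), whereas another one wins with
a probability `δ` that decreases exponentially with `H` (`ert_duel_of_not_lt`).  If the challenger is
not smaller then the duel takes constant expected time, otherwise it takes time `O(H)`.

Trials are grouped into blocks of `m = Θ((n / k) log n)`, and the search ends when a champion has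
survived a whole block.

* A champion outside the `k` smallest elements survives a block with probability at most
  `(1 - k / (2 n)) ^ m`, which is far below `1 / n` (`ert_block_survive_le`).
* The height `H = Θ(log m)` makes `m * δ` small.  A block turns any champion into one of the about
  `n / (4 m)` smallest elements with constant probability (`ert_block_improve_le`), and such a
  champion survives a block with constant probability (`ert_block_replace_le`).  Hence the expected
  number of blocks is bounded (`ert_repeat_block_le`).
* A block takes expected time `O(m + H ^ 2) = O(m)` (`ert_block_time_le`): the expensive duels are
  those with a smaller challenger, and a potential that is proportional to the rank of the champion
  pays for them, because such a challenger is likely to lower it.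

So the error probability is at most `1 / n` and the expected time is `O((n / k) log n)`; the second
term of the time bound in the theorem is not needed.

All this is expressed in a calculus of expected costs, `ert`, that is defined by recursion on the
program, with a rule for loops that asks for an invariant function that does not increase in
expectation.  The calculus is sound for the machine because its bound on the expected future cost,
together with the cost incurred so far, is a supermartingale along every run
(`sum_unhalted_add_pexp_le`).  With unit costs it bounds the expected time, and with cost zero the
probability of a wrong answer.
-/

noncomputable section

namespace FTMin

/-! ### Expectations of extended nonnegative functions -/

/-- The expectation of `f` under `p`. -/
def pexp {α : Type*} (p : PMF α) (f : α → ℝ≥0∞) : ℝ≥0∞ := ∑' x, p x * f x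

section pexp

variable {α β : Type*}

theorem pexp_pure (x : α) (f : α → ℝ≥0∞) : pexp (PMF.pure x) f = f x := by
  unfold pexp
  rw [tsum_eq_single x]
  · simp
  · intro y hy
    simp [PMF.pure_apply, hy]

theorem pexp_bind (p : PMF α) (q : α → PMF β) (f : β → ℝ≥0∞) :
    pexp (p.bind q) f = pexp p fun x => pexp (q x) f := by
  unfold pexp
  simp_rw [PMF.bind_apply, ← ENNReal.tsum_mul_right, ← ENNReal.tsum_mul_left]
  rw [ENNReal.tsum_comm]
  simp_rw [mul_assoc]

theorem pexp_map (p : PMF α) (g : α → β) (f : β → ℝ≥0∞) :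
    pexp (p.map g) f = pexp p fun x => f (g x) := by
  rw [PMF.map, pexp_bind]
  simp [pexp_pure]

theorem pexp_mono (p : PMF α) {f g : α → ℝ≥0∞} (h : ∀ x, f x ≤ g x) : pexp p f ≤ pexp p g :=
  ENNReal.tsum_le_tsum fun x => by gcongr; exact h x

theorem pexp_add (p : PMF α) (f g : α → ℝ≥0∞) :
    pexp p (fun x => f x + g x) = pexp p f + pexp p g := by
  unfold pexp
  rw [← ENNReal.tsum_add]
  simp_rw [mul_add]

theorem pexp_const_mul (p : PMF α) (c : ℝ≥0∞) (f : α → ℝ≥0∞) :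
    pexp p (fun x => c * f x) = c * pexp p f := by
  unfold pexp
  rw [← ENNReal.tsum_mul_left]
  congr 1; ext x; ring

theorem pexp_const (p : PMF α) (c : ℝ≥0∞) : pexp p (fun _ => c) = c := by
  unfold pexp
  rw [ENNReal.tsum_mul_right, p.tsum_coe, one_mul]

theorem toOuterMeasure_eq_pexp (p : PMF α) (s : Set α) :
    p.toOuterMeasure s = pexp p (s.indicator 1) := by
  rw [PMF.toOuterMeasure_apply]
  unfold pexp
  congr 1; ext x
  by_cases h : x ∈ s <;> simp [h]

end pexp

theorem pexp_uniformBelow {n : ℕ} (hn : 0 < n) (f : ℕ → ℝ≥0∞) :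
    pexp (uniformBelow n) f = (∑ i : Fin n, f i) / n := by
  obtain ⟨v, rfl⟩ : ∃ v, n = v + 1 := ⟨n - 1, by omega⟩
  rw [uniformBelow, pexp_map, pexp, tsum_fintype]
  simp only [PMF.uniformOfFintype_apply, Fintype.card_fin]
  rw [← Finset.mul_sum, ENNReal.div_eq_inv_mul]

/-! ### A calculus of expected costs -/

section Calculus

variable {n : ℕ} (rank : Equiv.Perm (Fin n)) (err : ℕ → Fin n → Fin n → unitInterval)

/-- An upper bound on the expectation of "`a` times the running time of the program, plus `f` at the
final state", as a function of the initial state.  For a loop it is the infimum of all functions `I`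
of the state that do not increase in expectation over one round of the loop, its cost included. -/
def ert (a : ℝ≥0∞) : Prog → (State → ℝ≥0∞) → State → ℝ≥0∞
  | .skip, f, σ => a + f σ
  | .const r c, f, σ => a + f (σ.setReg r c)
  | .add r s t, f, σ => a + f (σ.setReg r (σ.reg s + σ.reg t))
  | .sub r s t, f, σ => a + f (σ.setReg r (σ.reg s - σ.reg t))
  | .load r b s, f, σ => a + f (σ.setReg r (σ.arr b (σ.reg s)))
  | .store b s r, f, σ => a + f (σ.setArr b (σ.reg s) (σ.reg r))
  | .rand r s, f, σ => a + pexp (uniformBelow (σ.reg s)) fun v => f (σ.setReg r v)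
  | .cmp r s t, f, σ => a + pexp (compareStep rank err σ r s t) f
  | .seq P Q, f, σ => a + ert a P (ert a Q f) σ
  | .ifLt r s P Q, f, σ => a + if σ.reg r < σ.reg s then ert a P f σ else ert a Q f σ
  | .whileLt r s P, f, σ =>
      ⨅ (I : State → ℝ≥0∞)
        (_ : ∀ τ : State, a + (if τ.reg r < τ.reg s then ert a P I τ else f τ) ≤ I τ), I σ

variable {rank err}

theorem ert_while_le {a : ℝ≥0∞} {r s : ℕ} {P : Prog} {f : State → ℝ≥0∞} (I : State → ℝ≥0∞)
    (h : ∀ τ : State, a + (if τ.reg r < τ.reg s then ert rank err a P I τ else f τ) ≤ I τ)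
    (σ : State) : ert rank err a (.whileLt r s P) f σ ≤ I σ :=
  iInf₂_le (f := fun (I : State → ℝ≥0∞) _ => I σ) I h

theorem ert_mono (a : ℝ≥0∞) (P : Prog) {f g : State → ℝ≥0∞} (h : ∀ σ, f σ ≤ g σ) (σ : State) :
    ert rank err a P f σ ≤ ert rank err a P g σ := by
  induction P generalizing f g σ with
  | skip | const | add | sub | load | store => exact add_le_add_right (h _) a
  | rand => exact add_le_add_right (pexp_mono _ fun _ => h _) a
  | cmp => exact add_le_add_right (pexp_mono _ fun _ => h _) a
  | seq P Q ihP ihQ => exact add_le_add_right (ihP (fun τ => ihQ h τ) σ) a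
  | ifLt r s P Q ihP ihQ =>
    refine add_le_add_right ?_ a
    split_ifs
    exacts [ihP h σ, ihQ h σ]
  | whileLt r s P ih =>
    refine le_iInf₂ fun I hI => ert_while_le I (fun τ => le_trans ?_ (hI τ)) σ
    gcongr
    split_ifs
    exacts [le_rfl, h τ]

/-- The expected costs of two cost models add up. -/
theorem ert_add (a b : ℝ≥0∞) (P : Prog) (f g : State → ℝ≥0∞) (σ : State) :
    ert rank err (a + b) P (fun τ => f τ + g τ) σ ≤
      ert rank err a P f σ + ert rank err b P g σ := by
  induction P generalizing f g σ with
  | skip | const | add | sub | load | store => simp only [ert]; exact (add_add_add_comm _ _ _ _).le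
  | rand => simp only [ert, pexp_add]; exact (add_add_add_comm _ _ _ _).le
  | cmp => simp only [ert, pexp_add]; exact (add_add_add_comm _ _ _ _).le
  | seq P Q ihP ihQ =>
    simp only [ert]
    rw [add_add_add_comm a]
    exact add_le_add_right ((ert_mono _ P (fun τ => ihQ f g τ) σ).trans (ihP _ _ σ)) _
  | ifLt r s P Q ihP ihQ =>
    simp only [ert]
    rw [add_add_add_comm a]
    refine add_le_add_right ?_ _
    split_ifs
    exacts [ihP f g σ, ihQ f g σ]
  | whileLt r s P ih =>
    simp only [ert]
    simp only [ENNReal.iInf_add, ENNReal.add_iInf]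
    refine le_iInf₂ fun I hI => le_iInf₂ fun J hJ => ?_
    refine ert_while_le (fun τ => J τ + I τ) (fun τ => ?_) σ
    refine le_trans ?_ (add_le_add (hJ τ) (hI τ))
    rw [add_add_add_comm a]
    gcongr
    split_ifs
    exacts [ih J I τ, le_rfl]

theorem ert_smul {c : ℝ≥0∞} (hc₀ : c ≠ 0) (hc : c ≠ ∞) (a : ℝ≥0∞) (P : Prog) (f : State → ℝ≥0∞)
    (σ : State) :
    ert rank err (c * a) P (fun τ => c * f τ) σ ≤ c * ert rank err a P f σ := by
  induction P generalizing f σ with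
  | skip | const | add | sub | load | store => simp only [ert, mul_add]; rfl
  | rand => simp only [ert, mul_add, pexp_const_mul]; rfl
  | cmp => simp only [ert, mul_add, pexp_const_mul]; rfl
  | seq P Q ihP ihQ =>
    simp only [ert, mul_add]
    exact add_le_add_right ((ert_mono _ P (fun τ => ihQ f τ) σ).trans (ihP _ σ)) _
  | ifLt r s P Q ihP ihQ =>
    simp only [ert, mul_add]
    refine add_le_add_right ?_ _
    split_ifs
    exacts [ihP f σ, ihQ f σ]
  | whileLt r s P ih =>
    simp only [ert]
    simp only [ENNReal.mul_iInf_of_ne hc₀ hc]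
    refine le_iInf₂ fun I hI => ?_
    refine ert_while_le (fun τ => c * I τ) (fun τ => ?_) σ
    refine le_trans ?_ (mul_le_mul_right (hI τ) c)
    rw [mul_add]
    gcongr
    split_ifs
    exacts [ih I τ, le_rfl]

variable (rank err) in
/-- The bound `ert` for a stack of programs. -/
def erts (a : ℝ≥0∞) : List Prog → (State → ℝ≥0∞) → State → ℝ≥0∞
  | [], f => f
  | P :: K, f => ert rank err a P (erts a K f)

/-- The bound `erts` does not increase in expectation along a run, the cost of the step included. -/
theorem erts_step_le (a : ℝ≥0∞) (f : State → ℝ≥0∞) (c : Config) :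
    (if c.todo ≠ [] then a else 0) +
        pexp (step rank err c) (fun c' => erts rank err a c'.todo f c'.state) ≤
      erts rank err a c.todo f c.state := by
  obtain ⟨K, σ⟩ := c
  rcases K with _ | ⟨P, K⟩
  · simp [step, pexp_pure]
  cases P with
  | skip | const | add | sub | load | store | seq => simp [step, pexp_pure, erts, ert]
  | rand => simp [step, pexp_map, erts, ert]
  | cmp => simp [step, pexp_map, erts, ert]
  | ifLt r s P Q =>
    simp only [step, pexp_pure, erts, ert]
    split_ifs <;> simp_all
  | whileLt r s P =>
    simp only [step, pexp_pure, ne_eq, reduceCtorEq, not_false_eq_true, if_true]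
    rw [erts, ert]
    refine le_iInf₂ fun I hI => le_trans ?_ (hI σ)
    gcongr
    split_ifs with h
    · simp only [erts]
      exact ert_mono _ _ (fun τ => ert_while_le I hI τ) σ
    · exact le_rfl

theorem sum_unhalted_add_pexp_le (a : ℝ≥0∞) (f : State → ℝ≥0∞) (c : Config) (t : ℕ) :
    a * ∑ s ∈ Finset.range t, (run rank err c s).toOuterMeasure {c | c.todo ≠ []} +
        pexp (run rank err c t) (fun c' => erts rank err a c'.todo f c'.state) ≤
      erts rank err a c.todo f c.state := by
  induction t with
  | zero => simp [run, pexp_pure]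
  | succ t ih =>
    refine le_trans ?_ ih
    rw [Finset.sum_range_succ, mul_add, add_assoc]
    gcongr
    rw [toOuterMeasure_eq_pexp, ← pexp_const_mul, run, pexp_bind, ← pexp_add]
    refine pexp_mono _ fun c' => le_trans (le_of_eq ?_) (erts_step_le a f c')
    by_cases h : c'.todo = [] <;> simp [h]

theorem expectedTime_le_ert (A : Prog) (k : ℕ) :
    expectedTime rank err A k ≤ ert rank err 1 A (fun _ => 0) (init A n k).state := by
  unfold expectedTime
  rw [ENNReal.tsum_eq_iSup_nat]
  refine iSup_le fun t => ?_
  have := sum_unhalted_add_pexp_le (rank := rank) (err := err) 1 (fun _ => 0) (init A n k) t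
  rw [one_mul] at this
  exact le_self_add.trans this

open Classical in
/-- If the expected running time is finite then the success probability is at least one minus the
probability of halting with a wrong answer. -/
theorem one_le_successProb_add_ert (A : Prog) (k : ℕ) (hT : expectedTime rank err A k ≠ ∞) :
    1 ≤ successProb rank err A k + ert rank err 0 A
      (fun σ => if ∃ i : Fin n, σ.reg 0 = i ∧ (rank i : ℕ) < k then 0 else 1)
      (init A n k).state := by
  set f : State → ℝ≥0∞ := fun σ => if ∃ i : Fin n, σ.reg 0 = i ∧ (rank i : ℕ) < k then 0 else 1
  set u : ℕ → ℝ≥0∞ := fun t => (run rank err (init A n k) t).toOuterMeasure {c | c.todo ≠ []}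
  have hu : Filter.Tendsto u Filter.atTop (nhds 0) := ENNReal.tendsto_atTop_zero_of_tsum_ne_top hT
  have key : ∀ t, 1 ≤ successProb rank err A k +
      ert rank err 0 A f (init A n k).state + u t := by
    intro t
    have h1 := sum_unhalted_add_pexp_le (rank := rank) (err := err) 0 f (init A n k) t
    rw [zero_mul, zero_add] at h1
    have h2 : (run rank err (init A n k) t).toOuterMeasure {c | IsSolution rank k c} ≤
        successProb rank err A k :=
      le_iSup (fun t => (run rank err (init A n k) t).toOuterMeasure {c | IsSolution rank k c}) t
    refine le_trans ?_ (add_le_add (add_le_add h2 h1) le_rfl)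
    simp only [u]
    rw [toOuterMeasure_eq_pexp, toOuterMeasure_eq_pexp, ← pexp_add, ← pexp_add]
    conv_lhs => rw [← pexp_const (run rank err (init A n k) t) 1]
    refine pexp_mono _ fun c => ?_
    by_cases hc : c.todo = []
    · by_cases hs : ∃ i : Fin n, c.state.reg 0 = i ∧ (rank i : ℕ) < k
      · have : c ∈ {c | IsSolution rank k c} := ⟨hc, hs⟩
        rw [Set.indicator_of_mem this]
        simp [add_assoc]
      · simp only [hc, erts, f, if_neg hs]
        exact le_add_right le_add_self
    · have : c ∈ {c : Config | c.todo ≠ []} := hc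
      rw [Set.indicator_of_mem this]
      exact le_add_self
  have := ge_of_tendsto' (Filter.Tendsto.const_add
    (successProb rank err A k + ert rank err 0 A f (init A n k).state) hu) key
  simpa using this

end Calculus

/-! ### The search program -/

/-- One round of a duel: compare the challenger in register `10` with the champion in register `7`,
and move the walk in register `11` up if the challenger is reported to be smaller, and down
otherwise.  If the walk reaches the height in register `5` then the challenger becomes the champion,
the flag in register `8` is set, and the walk is put to `0`, which ends the duel. -/
def duelRound : Prog :=
  .seq (.cmp 12 10 7) (.seq (.ifLt 2 12 (.add 11 11 3) (.sub 11 11 3))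
    (.ifLt 11 5 .skip (.seq (.add 7 10 2) (.seq (.const 8 1) (.const 11 0)))))

/-- A duel: a random walk that is run until it is at `0`.  A smaller challenger makes it drift
upwards, any other one downwards. -/
def duel : Prog := .whileLt 2 11 duelRound

/-- A duel of the champion with a random challenger, starting at the height in register `6`. -/
def trial : Prog := .seq (.rand 10 0) (.seq (.add 11 6 2) duel)

/-- Clear the flag, then make as many trials as register `4` says. -/
def block : Prog :=
  .seq (.const 8 0) (.seq (.add 9 4 2) (.whileLt 2 9 (.seq (.sub 9 9 3) trial)))

/-- Repeat blocks of trials until the champion survives a whole block. -/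
def search : Prog := .seq (.whileLt 2 8 block) (.add 0 7 2)

/-- The contents of the registers during the search: the champion is `x`, the flag is `fl`, and `c`
trials remain in the current block; `m` is the number of trials in a block, and a duel starts at
height `a` and is won at height `H`. -/
structure At {n : ℕ} (m H a : ℕ) (x : Fin n) (fl c : ℕ) (σ : State) : Prop where
  size : σ.reg 0 = n
  zero : σ.reg 2 = 0
  one : σ.reg 3 = 1
  trials : σ.reg 4 = m
  height : σ.reg 5 = H
  start : σ.reg 6 = a
  champion : σ.reg 7 = x
  flag : σ.reg 8 = fl
  left : σ.reg 9 = c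

variable {n : ℕ} {rank : Equiv.Perm (Fin n)} {err : ℕ → Fin n → Fin n → unitInterval} {p : ℝ}

theorem pexp_fault (e : unitInterval) (f : Bool → ℝ≥0∞) :
    pexp (fault e) f = ENNReal.ofReal e * f true + ENNReal.ofReal (1 - e) * f false := by
  rw [pexp, tsum_fintype, Fintype.sum_bool]
  simp [fault]

/-- A comparison of `y` with `x` answers `1` with a probability `q` that is at least `1 - p` if `y`
is smaller than `x`, and at most `p` otherwise. -/
theorem pexp_compareStep (hp : p < 1 / 2) (herr : ∀ m i j, (err m i j : ℝ) ≤ p) (σ : State)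
    (r s t : ℕ) (y x : Fin n) (hy : σ.reg s = y) (hx : σ.reg t = x) :
    ∃ q : ℝ, 0 ≤ q ∧ q ≤ 1 ∧ (rank y < rank x → 1 - p ≤ q) ∧ (¬ rank y < rank x → q ≤ p) ∧
      ∀ f : State → ℝ≥0∞, pexp (compareStep rank err σ r s t) f =
        ENNReal.ofReal q * f { σ.setReg r 1 with cmps := σ.cmps + 1 } +
          ENNReal.ofReal (1 - q) * f { σ.setReg r 0 with cmps := σ.cmps + 1 } := by
  have h : σ.reg s < n ∧ σ.reg t < n := ⟨hy ▸ y.2, hx ▸ x.2⟩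
  have hy' : (⟨σ.reg s, h.1⟩ : Fin n) = y := Fin.ext hy
  have hx' : (⟨σ.reg t, h.2⟩ : Fin n) = x := Fin.ext hx
  have he := herr σ.cmps y x
  have he0 := (err σ.cmps y x).2.1
  have he1 := (err σ.cmps y x).2.2
  by_cases hr : rank y < rank x
  · refine ⟨1 - err σ.cmps y x, by linarith, by linarith, fun _ => by linarith,
      fun h => absurd hr h, fun f => ?_⟩
    rw [compareStep, dif_pos h, pexp_map, pexp_fault]
    simp only [hy', hx', hr, sub_sub_cancel]
    rw [add_comm]
    simp
  · refine ⟨err σ.cmps y x, by linarith, by linarith, fun h => absurd h hr,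
      fun _ => he, fun f => ?_⟩
    rw [compareStep, dif_pos h, pexp_map, pexp_fault]
    simp only [hy', hx', hr]
    simp

/-- One round of a duel at an intermediate height `w`. -/
theorem duelRound_spec (hp : p < 1 / 2) (herr : ∀ m i j, (err m i j : ℝ) ≤ p) {m H a : ℕ}
    {x y : Fin n} {fl c w : ℕ} {σ : State} (hσ : At m H a x fl c σ) (hy : σ.reg 10 = y)
    (hw : σ.reg 11 = w) (hw₀ : 0 < w) (hwH : w < H) :
    ∃ q : ℝ, 0 ≤ q ∧ q ≤ 1 ∧ (rank y < rank x → 1 - p ≤ q) ∧ (¬ rank y < rank x → q ≤ p) ∧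
      ∃ σ₁ σ₂ : State,
        (if w + 1 < H then At m H a x fl c σ₁ ∧ σ₁.reg 10 = y ∧ σ₁.reg 11 = w + 1
          else At m H a y 1 c σ₁ ∧ σ₁.reg 11 = 0) ∧
        (At m H a x fl c σ₂ ∧ σ₂.reg 10 = y ∧ σ₂.reg 11 = w - 1) ∧
        ∀ (b : ℝ≥0∞) (f : State → ℝ≥0∞), ert rank err b duelRound f σ ≤
          11 * b + (ENNReal.ofReal q * f σ₁ + ENNReal.ofReal (1 - q) * f σ₂) := by
  obtain ⟨h0, h2, h3, h4, h5, h6, h7, h8, h9⟩ := hσ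
  obtain ⟨q, hq0, hq1, hq2, hq3, hq⟩ :=
    pexp_compareStep (rank := rank) hp herr σ 12 10 7 y x hy h7
  set τ₁ : State := { (σ.setReg 12 1).setReg 11 (w + 1) with cmps := σ.cmps + 1 } with hτ₁
  set τ₂ : State := { (σ.setReg 12 0).setReg 11 (w - 1) with cmps := σ.cmps + 1 } with hτ₂
  have h1q : ENNReal.ofReal q + ENNReal.ofReal (1 - q) = 1 := by
    rw [← ENNReal.ofReal_add hq0 (by linarith)]; simp
  refine ⟨q, hq0, hq1, hq2, hq3,
    if w + 1 < H then τ₁ else ((τ₁.setReg 7 y).setReg 8 1).setReg 11 0, τ₂, ?_, ?_, fun b f => ?_⟩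
  · split_ifs with h
    · refine ⟨⟨?_, ?_, ?_, ?_, ?_, ?_, ?_, ?_, ?_⟩, ?_, ?_⟩ <;>
        simp [State.setReg, Function.update, *]
    · refine ⟨⟨?_, ?_, ?_, ?_, ?_, ?_, ?_, ?_, ?_⟩, ?_⟩ <;>
        simp [State.setReg, Function.update, *]
  · refine ⟨⟨?_, ?_, ?_, ?_, ?_, ?_, ?_, ?_, ?_⟩, ?_, ?_⟩ <;>
      simp [State.setReg, Function.update, *]
  · have hs1 : ert rank err b (.seq (.ifLt 2 12 (.add 11 11 3) (.sub 11 11 3))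
        (.ifLt 11 5 .skip (.seq (.add 7 10 2) (.seq (.const 8 1) (.const 11 0))))) f
        { σ.setReg 12 1 with cmps := σ.cmps + 1 } ≤ 9 * b + f (if w + 1 < H then τ₁ else
          ((τ₁.setReg 7 y).setReg 8 1).setReg 11 0) := by
      split_ifs with h
      · simp [ert, State.setReg, Function.update, *]
        simp only [← add_assoc]
        gcongr
        calc b + b + b + b + b = 5 * b := by ring
          _ ≤ 9 * b := by gcongr; norm_num
      · simp [ert, State.setReg, Function.update, *]
        simp only [← add_assoc]
        apply le_of_eq
        congr 1
        ring
    have hs2 : ert rank err b (.seq (.ifLt 2 12 (.add 11 11 3) (.sub 11 11 3))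
        (.ifLt 11 5 .skip (.seq (.add 7 10 2) (.seq (.const 8 1) (.const 11 0))))) f
        { σ.setReg 12 0 with cmps := σ.cmps + 1 } ≤ 9 * b + f τ₂ := by
      have h : w - 1 < H := by omega
      simp [ert, State.setReg, Function.update, *]
      simp only [← add_assoc]
      gcongr
      calc b + b + b + b + b = 5 * b := by ring
        _ ≤ 9 * b := by gcongr; norm_num
    rw [duelRound, ert, ert, hq]
    calc _ ≤ b + (b + (ENNReal.ofReal q * (9 * b + f (if w + 1 < H then τ₁ else
          ((τ₁.setReg 7 y).setReg 8 1).setReg 11 0)) +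
          ENNReal.ofReal (1 - q) * (9 * b + f τ₂))) := by gcongr
      _ = 2 * b + (ENNReal.ofReal q + ENNReal.ofReal (1 - q)) * (9 * b) +
          (ENNReal.ofReal q * f (if w + 1 < H then τ₁ else
          ((τ₁.setReg 7 y).setReg 8 1).setReg 11 0) +
          ENNReal.ofReal (1 - q) * f τ₂) := by ring
      _ = _ := by rw [h1q]; ring

/-- The rule for duels: `φ w` bounds the expectation of what is still to come at height `w`, and `A`
bounds the final value after a win of the challenger.  The extra `b` at the end of a duel is the cost
of the last test of the loop. -/
theorem ert_duel_le (hp : p < 1 / 2) (herr : ∀ m i j, (err m i j : ℝ) ≤ p) {m H a : ℕ}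
    {x y : Fin n} {fl c : ℕ} {b : ℝ≥0∞} {f : State → ℝ≥0∞} (φ : ℕ → ℝ≥0∞) (A : ℝ≥0∞)
    (hA : ∀ τ, At m H a y 1 c τ → f τ ≤ A) (hB : ∀ τ, At m H a x fl c τ → f τ + b ≤ φ 0)
    (hφ : ∀ q : ℝ, 0 ≤ q → q ≤ 1 → (rank y < rank x → 1 - p ≤ q) →
      (¬ rank y < rank x → q ≤ p) → ∀ w, 0 < w → w < H →
      12 * b + (ENNReal.ofReal q * (if w + 1 < H then φ (w + 1) else A + b) +
        ENNReal.ofReal (1 - q) * φ (w - 1)) ≤ φ w)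
    {σ : State} (hσ : At m H a x fl c σ) (hy : σ.reg 10 = y) {w : ℕ} (hw : σ.reg 11 = w)
    (hw₀ : 0 < w) (hwH : w < H) :
    ert rank err b duel f σ ≤ φ w := by
  classical
  let I : State → ℝ≥0∞ := fun τ => if τ.reg 2 < τ.reg 11 then
    (if At m H a x fl c τ ∧ τ.reg 10 = y ∧ τ.reg 11 < H then φ (τ.reg 11) else ∞) else b + f τ
  have hI : I σ = φ w := by
    simp only [I]
    rw [if_pos (by rw [hσ.zero, hw]; exact hw₀), if_pos ⟨hσ, hy, hw ▸ hwH⟩, hw]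
  rw [← hI]
  refine ert_while_le I (fun τ => ?_) σ
  by_cases h : τ.reg 2 < τ.reg 11
  swap
  · simp only [h, I, if_false]; exact le_rfl
  by_cases h' : At m H a x fl c τ ∧ τ.reg 10 = y ∧ τ.reg 11 < H
  swap
  · have : I τ = ∞ := by simp only [I]; rw [if_pos h, if_neg h']
    rw [this]; exact le_top
  have : I τ = φ (τ.reg 11) := by simp only [I]; rw [if_pos h, if_pos h']
  rw [this, if_pos h]
  obtain ⟨hτ, hτy, hτH⟩ := h'
  rw [hτ.zero] at h
  obtain ⟨q, hq0, hq1, hq2, hq3, σ₁, σ₂, h1, h2, hround⟩ :=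
    duelRound_spec (rank := rank) hp herr hτ hτy rfl h hτH
  have hI1 : I σ₁ ≤ if τ.reg 11 + 1 < H then φ (τ.reg 11 + 1) else A + b := by
    split_ifs at h1 ⊢ with hlt
    · simp only [I]
      rw [if_pos (by rw [h1.1.zero, h1.2.2]; omega), if_pos ⟨h1.1, h1.2.1, h1.2.2 ▸ hlt⟩, h1.2.2]
    · simp only [I]
      rw [if_neg (by rw [h1.1.zero, h1.2]; omega), add_comm]
      gcongr
      exact hA _ h1.1
  have hI2 : I σ₂ ≤ φ (τ.reg 11 - 1) := by
    by_cases hlt : 0 < τ.reg 11 - 1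
    · simp only [I]
      rw [if_pos (by rw [h2.1.zero, h2.2.2]; omega), if_pos ⟨h2.1, h2.2.1, h2.2.2 ▸ by omega⟩,
        h2.2.2]
    · simp only [I]
      rw [if_neg (by rw [h2.1.zero, h2.2.2]; omega), add_comm,
        show τ.reg 11 - 1 = 0 by omega]
      exact hB _ h2.1
  refine le_trans ?_ (hφ q hq0 hq1 hq2 hq3 _ h hτH)
  calc _ ≤ b + (11 * b + (ENNReal.ofReal q * I σ₁ + ENNReal.ofReal (1 - q) * I σ₂)) := by
        gcongr; exact hround b I
    _ = 12 * b + (ENNReal.ofReal q * I σ₁ + ENNReal.ofReal (1 - q) * I σ₂) := by ring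
    _ ≤ _ := by gcongr

/-- A challenger that is smaller than the champion wins with probability at least `1 - ρ ^ w`. -/
theorem ert_duel_of_lt (hp : p < 1 / 2) (herr : ∀ m i j, (err m i j : ℝ) ≤ p) {ρ : ℝ}
    (hρ₀ : 0 < ρ) (hρ₁ : ρ < 1) (hρ : p + (1 - p) * ρ ^ 2 ≤ ρ) {m H a : ℕ}
    {x y : Fin n} {fl c : ℕ} {f : State → ℝ≥0∞} {A D : ℝ≥0∞} (hxy : rank y < rank x)
    (hA : ∀ τ, At m H a y 1 c τ → f τ ≤ A) (hB : ∀ τ, At m H a x fl c τ → f τ ≤ A + D)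
    {σ : State} (hσ : At m H a x fl c σ) (hy : σ.reg 10 = y) {w : ℕ} (hw : σ.reg 11 = w)
    (hw₀ : 0 < w) (hwH : w < H) :
    ert rank err 0 duel f σ ≤ A + ENNReal.ofReal (ρ ^ w) * D := by
  refine ert_duel_le (rank := rank) hp herr (fun w => A + ENNReal.ofReal (ρ ^ w) * D) A hA
    (by simpa using hB) ?_ hσ hy hw hw₀ hwH
  intro q hq0 hq1 hq2 _ w hw0 _
  obtain ⟨v, rfl⟩ : ∃ v, w = v + 1 := ⟨w - 1, by omega⟩
  have h1q : ENNReal.ofReal q + ENNReal.ofReal (1 - q) = 1 := by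
    rw [← ENNReal.ofReal_add hq0 (by linarith)]; simp
  have hup : (if v + 1 + 1 < H then A + ENNReal.ofReal (ρ ^ (v + 1 + 1)) * D else A + 0) ≤
      A + ENNReal.ofReal (ρ ^ (v + 1 + 1)) * D := by
    split_ifs
    · exact le_rfl
    · simp
  calc _ ≤ 12 * 0 + (ENNReal.ofReal q * (A + ENNReal.ofReal (ρ ^ (v + 1 + 1)) * D) +
        ENNReal.ofReal (1 - q) * (A + ENNReal.ofReal (ρ ^ v) * D)) := by 
        exact add_le_add_right (add_le_add (mul_le_mul_right hup _) le_rfl) _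
    _ = (ENNReal.ofReal q + ENNReal.ofReal (1 - q)) * A +
        (ENNReal.ofReal q * ENNReal.ofReal (ρ ^ (v + 1 + 1)) +
          ENNReal.ofReal (1 - q) * ENNReal.ofReal (ρ ^ v)) * D := by ring
    _ ≤ _ := by
      rw [h1q, one_mul, ← ENNReal.ofReal_mul hq0, ← ENNReal.ofReal_mul (by linarith),
        ← ENNReal.ofReal_add (by positivity) (mul_nonneg (by linarith) (by positivity))]
      gcongr
      have hq := hq2 hxy
      have h1 : q * ρ ^ 2 + (1 - q) ≤ ρ := by nlinarith
      calc q * ρ ^ (v + 1 + 1) + (1 - q) * ρ ^ v = ρ ^ v * (q * ρ ^ 2 + (1 - q)) := by ring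
        _ ≤ ρ ^ v * ρ := by gcongr
        _ = ρ ^ (v + 1) := by ring

/-- A challenger that is not smaller than the champion wins with probability at most
`ρ ^ (H - w)`. -/
theorem ert_duel_of_not_lt (hp : p < 1 / 2) (herr : ∀ m i j, (err m i j : ℝ) ≤ p) {ρ : ℝ}
    (hρ₀ : 0 < ρ) (hρ₁ : ρ < 1) (hρ : p + (1 - p) * ρ ^ 2 ≤ ρ) {m H a : ℕ}
    {x y : Fin n} {fl c : ℕ} {f : State → ℝ≥0∞} {B D : ℝ≥0∞} (hxy : ¬ rank y < rank x)
    (hA : ∀ τ, At m H a y 1 c τ → f τ ≤ B + D) (hB : ∀ τ, At m H a x fl c τ → f τ ≤ B)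
    {σ : State} (hσ : At m H a x fl c σ) (hy : σ.reg 10 = y) {w : ℕ} (hw : σ.reg 11 = w)
    (hw₀ : 0 < w) (hwH : w < H) :
    ert rank err 0 duel f σ ≤ B + ENNReal.ofReal (ρ ^ (H - w)) * D := by
  refine ert_duel_le (rank := rank) hp herr (fun w => B + ENNReal.ofReal (ρ ^ (H - w)) * D)
    (B + D) hA (fun τ h => by rw [add_zero]; exact le_add_right (hB τ h)) ?_ hσ hy hw hw₀ hwH
  intro q hq0 hq1 _ hq3 w hw0 hwH
  obtain ⟨v, rfl⟩ : ∃ v, H = w + v + 1 := ⟨H - w - 1, by omega⟩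
  have h1q : ENNReal.ofReal q + ENNReal.ofReal (1 - q) = 1 := by
    rw [← ENNReal.ofReal_add hq0 (by linarith)]; simp
  have hup : (if w + 1 < w + v + 1 then B + ENNReal.ofReal (ρ ^ (w + v + 1 - (w + 1))) * D
      else B + D + 0) ≤ B + ENNReal.ofReal (ρ ^ v) * D := by
    rw [show w + v + 1 - (w + 1) = v by omega]
    split_ifs with h
    · exact le_rfl
    · simp [show v = 0 by omega]
  rw [show w + v + 1 - (w - 1) = v + 2 by omega, show w + v + 1 - w = v + 1 by omega]
  calc _ ≤ 12 * 0 + (ENNReal.ofReal q * (B + ENNReal.ofReal (ρ ^ v) * D) +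
        ENNReal.ofReal (1 - q) * (B + ENNReal.ofReal (ρ ^ (v + 2)) * D)) := by 
        exact add_le_add_right (add_le_add (mul_le_mul_right hup _) le_rfl) _
    _ = (ENNReal.ofReal q + ENNReal.ofReal (1 - q)) * B +
        (ENNReal.ofReal q * ENNReal.ofReal (ρ ^ v) +
          ENNReal.ofReal (1 - q) * ENNReal.ofReal (ρ ^ (v + 2))) * D := by ring
    _ ≤ _ := by
      rw [h1q, one_mul, ← ENNReal.ofReal_mul hq0, ← ENNReal.ofReal_mul (by linarith),
        ← ENNReal.ofReal_add (by positivity) (mul_nonneg (by linarith) (by positivity))]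
      gcongr
      have hq := hq3 hxy
      have h1 : q + (1 - q) * ρ ^ 2 ≤ ρ := by nlinarith
      calc q * ρ ^ v + (1 - q) * ρ ^ (v + 2) = ρ ^ v * (q + (1 - q) * ρ ^ 2) := by ring
        _ ≤ ρ ^ v * ρ := by gcongr
        _ = ρ ^ (v + 1) := by ring

/-- The expected duration of a duel with a smaller challenger is at most proportional to `H`. -/
theorem ert_duel_time_of_lt (hp : p < 1 / 2) (herr : ∀ m i j, (err m i j : ℝ) ≤ p) {m H a : ℕ}
    {x y : Fin n} {fl c : ℕ} (hxy : rank y < rank x)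
    {σ : State} (hσ : At m H a x fl c σ) (hy : σ.reg 10 = y) {w : ℕ} (hw : σ.reg 11 = w)
    (hw₀ : 0 < w) (hwH : w < H) :
    ert rank err 1 duel (fun _ => 0) σ ≤ ENNReal.ofReal (1 + 12 / (1 - 2 * p) * (H - w)) := by
  have hκ : 0 < 12 / (1 - 2 * p) := div_pos (by norm_num) (by linarith)
  set κ := 12 / (1 - 2 * p) with hκd
  have hκ' : κ * (1 - 2 * p) = 12 := by rw [hκd]; field_simp [show (1 - 2 * p) ≠ 0 by linarith]
  refine ert_duel_le (rank := rank) hp herr (fun w => ENNReal.ofReal (1 + κ * (H - w))) 0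
    (fun _ _ => le_rfl) (fun _ _ => ?_) ?_ hσ hy hw hw₀ hwH
  · rw [zero_add, ENNReal.one_le_ofReal]
    have : 0 ≤ κ * ((H : ℝ) - (0 : ℕ)) := by simp; positivity
    linarith
  intro q hq0 hq1 hq2 _ w hw0 hwH
  obtain ⟨v, rfl⟩ : ∃ v, w = v + 1 := ⟨w - 1, by omega⟩
  have hvH : (v : ℝ) + 2 ≤ H := by exact_mod_cast hwH
  have hup : (if v + 1 + 1 < H then ENNReal.ofReal (1 + κ * (H - (v + 1 + 1 : ℕ))) else 0 + 1) ≤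
      ENNReal.ofReal (1 + κ * (H - (v + 2))) := by
    split_ifs with h
    · apply le_of_eq; congr 1; push_cast; ring
    · rw [zero_add, ENNReal.one_le_ofReal]
      nlinarith
  have h12 : (12 * 1 : ℝ≥0∞) = ENNReal.ofReal 12 := by norm_num
  have e2 : 0 ≤ 1 + κ * ((H : ℝ) - (v + 2)) := by nlinarith
  have e3 : 0 ≤ 1 + κ * ((H : ℝ) - v) := by nlinarith
  calc _ ≤ 12 * 1 + (ENNReal.ofReal q * ENNReal.ofReal (1 + κ * (H - (v + 2))) +
        ENNReal.ofReal (1 - q) * ENNReal.ofReal (1 + κ * (H - v))) := by 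
        exact add_le_add_right (add_le_add (mul_le_mul_right hup _) le_rfl) _
    _ = ENNReal.ofReal (12 + (q * (1 + κ * (H - (v + 2))) + (1 - q) * (1 + κ * (H - v)))) := by
      have e4 : 0 ≤ 1 - q := by linarith
      rw [h12, ← ENNReal.ofReal_mul hq0, ← ENNReal.ofReal_mul e4, ← ENNReal.ofReal_add
        (by positivity) (by positivity), ← ENNReal.ofReal_add (by positivity) (by positivity)]
    _ ≤ _ := by
      refine ENNReal.ofReal_le_ofReal ?_
      have hq := hq2 hxy
      push_cast
      nlinarith

/-- The expected duration of a duel with a challenger that is not smaller than the champion is at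
most proportional to the initial height. -/
theorem ert_duel_time_of_not_lt (hp : p < 1 / 2) (herr : ∀ m i j, (err m i j : ℝ) ≤ p)
    {m H a : ℕ} {x y : Fin n} {fl c : ℕ} (hxy : ¬ rank y < rank x)
    {σ : State} (hσ : At m H a x fl c σ) (hy : σ.reg 10 = y) {w : ℕ} (hw : σ.reg 11 = w)
    (hw₀ : 0 < w) (hwH : w < H) :
    ert rank err 1 duel (fun _ => 0) σ ≤ ENNReal.ofReal (1 + 12 / (1 - 2 * p) * w) := by
  have hκ : 0 < 12 / (1 - 2 * p) := div_pos (by norm_num) (by linarith)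
  set κ := 12 / (1 - 2 * p) with hκd
  have hκ' : κ * (1 - 2 * p) = 12 := by rw [hκd]; field_simp [show (1 - 2 * p) ≠ 0 by linarith]
  refine ert_duel_le (rank := rank) hp herr (fun w => ENNReal.ofReal (1 + κ * w)) 0
    (fun _ _ => le_rfl) (fun _ _ => ?_) ?_ hσ hy hw hw₀ hwH
  · simp
  intro q hq0 hq1 _ hq3 w hw0 hwH
  obtain ⟨v, rfl⟩ : ∃ v, w = v + 1 := ⟨w - 1, by omega⟩
  have hup : (if v + 1 + 1 < H then ENNReal.ofReal (1 + κ * (v + 1 + 1 : ℕ)) else 0 + 1) ≤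
      ENNReal.ofReal (1 + κ * (v + 2)) := by
    split_ifs with h
    · apply le_of_eq; congr 1; push_cast; ring
    · rw [zero_add, ENNReal.one_le_ofReal]
      have : 0 ≤ κ * ((v : ℝ) + 2) := by positivity
      linarith
  have h12 : (12 * 1 : ℝ≥0∞) = ENNReal.ofReal 12 := by norm_num
  calc _ ≤ 12 * 1 + (ENNReal.ofReal q * ENNReal.ofReal (1 + κ * (v + 2)) +
        ENNReal.ofReal (1 - q) * ENNReal.ofReal (1 + κ * v)) := by 
        exact add_le_add_right (add_le_add (mul_le_mul_right hup _) le_rfl) _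
    _ = ENNReal.ofReal (12 + (q * (1 + κ * (v + 2)) + (1 - q) * (1 + κ * v))) := by
      have e4 : 0 ≤ 1 - q := by linarith
      rw [h12, ← ENNReal.ofReal_mul hq0, ← ENNReal.ofReal_mul e4, ← ENNReal.ofReal_add
        (by positivity) (by positivity), ← ENNReal.ofReal_add (by positivity) (by positivity)]
    _ ≤ _ := by
      refine ENNReal.ofReal_le_ofReal ?_
      have hq := hq3 hxy
      push_cast
      nlinarith

/-! ### Trials -/

variable (rank) in
/-- A bound on the expectation of a function after a trial with champion `x`, if the function is `B`
when the champion survives and `A y` when `y` takes over.  A smaller challenger fails with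
probability at most `1 / 2`, and another one succeeds with probability at most `δ`; as these
probabilities may also be smaller, the worse of the two extreme cases is taken. -/
def trialMean (δ : ℝ) (x : Fin n) (B : ℝ) (A : Fin n → ℝ) : ℝ :=
  (∑ y, if rank y < rank x then max (A y) ((A y + B) / 2) else max B (B + δ * (A y - B))) / n

variable (p err) in
/-- The standing assumptions on the parameters: `a` is the initial and `H` the final height of a
duel, and `ρ` is the ratio of the geometric supermartingale for the height. -/
structure Params (ρ : ℝ) (m H a : ℕ) : Prop where
  lt_half : p < 1 / 2
  err_le : ∀ m i j, (err m i j : ℝ) ≤ p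
  pos : 0 < ρ
  lt_one : ρ < 1
  superharmonic : p + (1 - p) * ρ ^ 2 ≤ ρ
  start_pos : 0 < a
  start_lt : a < H
  pow_start : ρ ^ a ≤ 1 / 2
  trials_pos : 0 < m
  trials_mul : m * ρ ^ (H - a) ≤ 1 / 32

variable {ρ : ℝ} {m H a : ℕ}

theorem ert_trial_le (h : Params err p ρ m H a) {x : Fin n} {fl c : ℕ} {f : State → ℝ≥0∞}
    {B : ℝ} {A : Fin n → ℝ} (hB₀ : 0 ≤ B) (hA₀ : ∀ y, 0 ≤ A y)
    (hA : ∀ y τ, At m H a y 1 c τ → f τ ≤ ENNReal.ofReal (A y))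
    (hB : ∀ τ, At m H a x fl c τ → f τ ≤ ENNReal.ofReal B) {σ : State}
    (hσ : At m H a x fl c σ) :
    ert rank err 0 trial f σ ≤ ENNReal.ofReal (trialMean rank (ρ ^ (H - a)) x B A) := by
  have hn : 0 < n := x.pos
  have hρ0 := h.pos
  obtain ⟨h0, h2, h3, h4, h5, h6, h7, h8, h9⟩ := hσ
  rw [trial, ert, ert, h0, pexp_uniformBelow hn, trialMean, ENNReal.ofReal_div_of_pos (by positivity),
    ENNReal.ofReal_natCast, zero_add, zero_add, ENNReal.ofReal_sum_of_nonneg]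
  swap
  · intro y _
    split_ifs
    exacts [le_max_of_le_left (hA₀ y), le_max_of_le_left hB₀]
  gcongr with y
  rw [ert, ert, zero_add, zero_add]
  have hτ : At m H a x fl c ((σ.setReg 10 y).setReg 11 a) := by
    refine ⟨?_, ?_, ?_, ?_, ?_, ?_, ?_, ?_, ?_⟩ <;> simp [State.setReg, Function.update, *]
  have heq : (σ.setReg 10 ↑y).setReg 11 ((σ.setReg 10 ↑y).reg 6 + (σ.setReg 10 ↑y).reg 2) =
      (σ.setReg 10 ↑y).setReg 11 a := by
    simp [State.setReg, Function.update, *]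
  have hy : ((σ.setReg 10 y).setReg 11 a).reg 10 = y := by simp [State.setReg, Function.update]
  have hw : ((σ.setReg 10 y).setReg 11 a).reg 11 = a := by simp [State.setReg]
  rw [heq]
  split_ifs with hxy
  · by_cases hAB : A y ≤ B
    · refine (ert_duel_of_lt (rank := rank) h.lt_half h.err_le h.pos h.lt_one h.superharmonic hxy
        (D := ENNReal.ofReal (B - A y)) (hA y) (fun τ hh => ?_) hτ hy hw h.start_pos
        h.start_lt).trans ?_
      · rw [← ENNReal.ofReal_add (hA₀ y) (by linarith)]
        simpa using hB τ hh
      · rw [← ENNReal.ofReal_mul (by positivity), ← ENNReal.ofReal_add (hA₀ y)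
          (mul_nonneg (by positivity) (by linarith))]
        refine ENNReal.ofReal_le_ofReal (le_max_of_le_right ?_)
        have := h.pow_start
        nlinarith
    · refine (ert_duel_of_lt (rank := rank) h.lt_half h.err_le h.pos h.lt_one h.superharmonic hxy
        (D := 0) (hA y) (fun τ hh => ?_) hτ hy hw h.start_pos h.start_lt).trans ?_
      · rw [add_zero]
        exact (hB τ hh).trans (ENNReal.ofReal_le_ofReal (by linarith))
      · rw [mul_zero, add_zero]
        exact ENNReal.ofReal_le_ofReal (le_max_left _ _)
  · by_cases hAB : B ≤ A y
    · refine (ert_duel_of_not_lt (rank := rank) h.lt_half h.err_le h.pos h.lt_one h.superharmonic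
        hxy (D := ENNReal.ofReal (A y - B)) (fun τ hh => ?_) hB hτ hy hw h.start_pos
        h.start_lt).trans ?_
      · rw [← ENNReal.ofReal_add hB₀ (by linarith)]
        simpa using hA y τ hh
      · rw [← ENNReal.ofReal_mul (by positivity), ← ENNReal.ofReal_add hB₀
          (mul_nonneg (by positivity) (by linarith))]
        exact ENNReal.ofReal_le_ofReal (le_max_right _ _)
    · refine (ert_duel_of_not_lt (rank := rank) h.lt_half h.err_le h.pos h.lt_one h.superharmonic
        hxy (D := 0) (fun τ hh => ?_) hB hτ hy hw h.start_pos h.start_lt).trans ?_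
      · rw [add_zero]
        exact (hA y τ hh).trans (ENNReal.ofReal_le_ofReal (by linarith))
      · rw [mul_zero, add_zero]
        exact ENNReal.ofReal_le_ofReal (le_max_left _ _)

theorem sum_ite_rank_lt {s : ℕ} (hs : s ≤ n) (u v : ℝ) :
    ∑ y, (if (rank y : ℕ) < s then u else v) = s * u + (n - s) * v := by
  obtain ⟨l, rfl⟩ := Nat.exists_eq_add_of_le hs
  rw [Equiv.sum_comp rank fun j => if (j : ℕ) < s then u else v,
    Fin.sum_univ_eq_sum_range (fun j => if j < s then u else v), Finset.sum_range_add,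
    Finset.sum_congr rfl fun j hj => if_pos (Finset.mem_range.1 hj),
    Finset.sum_congr rfl fun j _ => if_neg (by omega : ¬ s + j < s)]
  simp

theorem ert_trial_time_le (h : Params err p ρ m H a) {x : Fin n} {fl c : ℕ} {σ : State}
    (hσ : At m H a x fl c σ) :
    ert rank err 1 trial (fun _ => 0) σ ≤
      ENNReal.ofReal ((5 + 12 / (1 - 2 * p) * a) * (1 + rank x / n * H)) := by
  have hn : 0 < n := x.pos
  have hn' : (0 : ℝ) < n := by exact_mod_cast hn
  have hp := h.lt_half
  have hκ : 0 < 12 / (1 - 2 * p) := div_pos (by norm_num) (by linarith)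
  have ha : (1 : ℝ) ≤ a := by exact_mod_cast h.start_pos
  have haH : (a : ℝ) < H := by exact_mod_cast h.start_lt
  set κ := 12 / (1 - 2 * p) with hκd
  obtain ⟨h0, h2, h3, h4, h5, h6, h7, h8, h9⟩ := hσ
  rw [trial, ert, ert, h0, pexp_uniformBelow hn]
  have key : ∀ y : Fin n, ert rank err 1 (.seq (.add 11 6 2) duel) (fun _ => 0)
      (σ.setReg 10 y) ≤ ENNReal.ofReal (3 + κ * a + if (rank y : ℕ) < rank x then κ * H else 0) := by
    intro y
    have hτ : At m H a x fl c ((σ.setReg 10 y).setReg 11 a) := by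
      refine ⟨?_, ?_, ?_, ?_, ?_, ?_, ?_, ?_, ?_⟩ <;> simp [State.setReg, Function.update, *]
    have heq : (σ.setReg 10 ↑y).setReg 11 ((σ.setReg 10 ↑y).reg 6 + (σ.setReg 10 ↑y).reg 2) =
        (σ.setReg 10 ↑y).setReg 11 a := by
      simp [State.setReg, Function.update, *]
    have hy : ((σ.setReg 10 y).setReg 11 a).reg 10 = y := by simp [State.setReg, Function.update]
    have hw : ((σ.setReg 10 y).setReg 11 a).reg 11 = a := by simp [State.setReg]
    rw [ert, ert, heq, ← add_assoc, show (1 + 1 : ℝ≥0∞) = ENNReal.ofReal 2 by norm_num]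
    split_ifs with hxy
    · refine (add_le_add_right (ert_duel_time_of_lt (rank := rank) hp h.err_le hxy hτ hy hw
        h.start_pos h.start_lt) _).trans ?_
      rw [← ENNReal.ofReal_add (by norm_num) (by nlinarith)]
      refine ENNReal.ofReal_le_ofReal ?_
      nlinarith
    · refine (add_le_add_right (ert_duel_time_of_not_lt (rank := rank) hp h.err_le hxy hτ hy hw
        h.start_pos h.start_lt) _).trans ?_
      rw [← ENNReal.ofReal_add (by norm_num) (by positivity)]
      refine ENNReal.ofReal_le_ofReal ?_
      nlinarith
  have hR : ((rank x : ℕ) : ℝ) ≤ n := by exact_mod_cast (rank x).2.le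
  calc _ ≤ 1 + (1 + (∑ y : Fin n, ENNReal.ofReal
        (3 + κ * a + if (rank y : ℕ) < rank x then κ * H else 0)) / n) := by
        gcongr with y; exact key y
    _ = ENNReal.ofReal (2 + (∑ y : Fin n,
        (3 + κ * a + if (rank y : ℕ) < rank x then κ * H else 0)) / n) := by
      have hpos : ∀ y ∈ (Finset.univ : Finset (Fin n)),
          0 ≤ 3 + κ * a + if (rank y : ℕ) < rank x then κ * H else 0 := by
        intro y _
        split_ifs <;> positivity
      rw [ENNReal.ofReal_add (by norm_num) (div_nonneg (Finset.sum_nonneg hpos) hn'.le),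
        ENNReal.ofReal_div_of_pos hn', ENNReal.ofReal_natCast, ENNReal.ofReal_sum_of_nonneg hpos,
        ← add_assoc]
      norm_num
    _ ≤ _ := by
      refine ENNReal.ofReal_le_ofReal ?_
      rw [Finset.sum_add_distrib, sum_ite_rank_lt (rank x).2.le]
      simp only [Finset.sum_const, Finset.card_univ, Fintype.card_fin, nsmul_eq_mul, mul_zero,
        add_zero]
      have e1 : (n * (3 + κ * a) + rank x * (κ * H)) / n = 3 + κ * a + κ * (rank x / n * H) := by
        field_simp
      rw [e1]
      have e2 : 0 ≤ (rank x : ℝ) / n * H := by positivity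
      have e3 : κ * ((rank x : ℝ) / n * H) ≤ κ * a * ((rank x : ℝ) / n * H) := by
        gcongr; nlinarith
      nlinarith

/-! ### Blocks of trials -/

/-- The rule for a block of trials: `Φ c x fl` bounds the expectation of what is still to come when
`c` trials remain, where a trial with champion `x` takes expected time `T x`. -/
theorem ert_block_le (h : Params err p ρ m H a) {β : ℝ} (hβ : 0 ≤ β) {f : State → ℝ≥0∞}
    (T : Fin n → ℝ) (hT₀ : ∀ x, 0 ≤ T x)
    (hT : ∀ x fl c σ, At m H a x fl c σ →
      ert rank err (ENNReal.ofReal β) trial (fun _ => 0) σ ≤ ENNReal.ofReal (T x))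
    (Φ : ℕ → Fin n → ℕ → ℝ) (hΦ₀ : ∀ c x fl, 0 ≤ Φ c x fl)
    (hf : ∀ (x : Fin n) fl τ, At m H a x fl 0 τ → ENNReal.ofReal β + f τ ≤ ENNReal.ofReal (Φ 0 x fl))
    (hΦ : ∀ c x fl, 3 * β + T x + trialMean rank (ρ ^ (H - a)) x (Φ c x fl) (fun y => Φ c y 1) ≤
      Φ (c + 1) x fl)
    {x : Fin n} {fl c : ℕ} {σ : State} (hσ : At m H a x fl c σ) :
    ert rank err (ENNReal.ofReal β) block f σ ≤ ENNReal.ofReal (4 * β + Φ m x 0) := by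
  set b := ENNReal.ofReal β with hb
  let I : State → ℝ≥0∞ := fun τ =>
    ⨅ (x : Fin n) (fl : ℕ) (c : ℕ) (_ : At m H a x fl c τ), ENNReal.ofReal (Φ c x fl)
  have hIle : ∀ {x fl c τ}, At m H a x fl c τ → I τ ≤ ENNReal.ofReal (Φ c x fl) :=
    fun {x fl c τ} hτ => iInf_le_of_le x (iInf_le_of_le fl (iInf_le_of_le c (iInf_le _ hτ)))
  have hloop : ∀ τ, ert rank err b (.whileLt 2 9 (.seq (.sub 9 9 3) trial)) f τ ≤ I τ := by
    refine ert_while_le I fun τ => ?_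
    refine le_iInf fun x => le_iInf fun fl => le_iInf fun c => le_iInf fun hτ => ?_
    obtain ⟨h0, h2, h3, h4, h5, h6, h7, h8, h9⟩ := id hτ
    rw [h2, h9]
    rcases c with _ | c
    · simpa using hf x fl τ hτ
    rw [if_pos (by omega), ert, ert]
    have hτ' : At m H a x fl c (τ.setReg 9 (τ.reg 9 - τ.reg 3)) := by
      refine ⟨?_, ?_, ?_, ?_, ?_, ?_, ?_, ?_, ?_⟩ <;> simp [State.setReg, Function.update, *]
    have h1 : ert rank err b trial I (τ.setReg 9 (τ.reg 9 - τ.reg 3)) ≤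
        ENNReal.ofReal (T x) + ENNReal.ofReal
          (trialMean rank (ρ ^ (H - a)) x (Φ c x fl) (fun y => Φ c y 1)) := by
      have := ert_add (rank := rank) (err := err) b 0 trial (fun _ => 0) I
        (τ.setReg 9 (τ.reg 9 - τ.reg 3))
      simp only [add_zero, zero_add] at this
      refine this.trans (add_le_add (hT x fl c _ hτ') ?_)
      exact ert_trial_le h (hΦ₀ c x fl) (fun y => hΦ₀ c y 1) (fun y τ hh => hIle hh)
        (fun τ hh => hIle hh) hτ'
    have hmean : 0 ≤ trialMean rank (ρ ^ (H - a)) x (Φ c x fl) (fun y => Φ c y 1) := by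
      refine div_nonneg (Finset.sum_nonneg fun y _ => ?_) (by positivity)
      split_ifs
      exacts [le_max_of_le_left (hΦ₀ c y 1), le_max_of_le_left (hΦ₀ c x fl)]
    calc _ ≤ b + (b + (b + (ENNReal.ofReal (T x) + ENNReal.ofReal
          (trialMean rank (ρ ^ (H - a)) x (Φ c x fl) (fun y => Φ c y 1))))) := by gcongr
      _ = ENNReal.ofReal (3 * β + T x +
          trialMean rank (ρ ^ (H - a)) x (Φ c x fl) (fun y => Φ c y 1)) := by
        have := hT₀ x
        rw [hb, ENNReal.ofReal_add (by positivity) hmean, ENNReal.ofReal_add (by positivity) this,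
          ENNReal.ofReal_mul (by norm_num), ENNReal.ofReal_ofNat]
        ring
      _ ≤ _ := ENNReal.ofReal_le_ofReal (hΦ c x fl)
  obtain ⟨h0, h2, h3, h4, h5, h6, h7, h8, h9⟩ := id hσ
  rw [block, ert, ert, ert, ert]
  have hσ' : At m H a x 0 m ((σ.setReg 8 0).setReg 9
      ((σ.setReg 8 0).reg 4 + (σ.setReg 8 0).reg 2)) := by
    refine ⟨?_, ?_, ?_, ?_, ?_, ?_, ?_, ?_, ?_⟩ <;> simp [State.setReg, Function.update, *]
  calc _ ≤ b + (b + (b + (b + ENNReal.ofReal (Φ m x 0)))) := by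
        gcongr; exact (hloop _).trans (hIle hσ')
    _ = _ := by
      rw [ENNReal.ofReal_add (by positivity) (hΦ₀ _ _ _), ENNReal.ofReal_mul (by norm_num),
        ENNReal.ofReal_ofNat]
      ring

/-- The rule `ert_block_le` for probabilities. -/
theorem ert_block_prob_le (h : Params err p ρ m H a) {f : State → ℝ≥0∞}
    (Φ : ℕ → Fin n → ℕ → ℝ) (hΦ₀ : ∀ c x fl, 0 ≤ Φ c x fl)
    (hf : ∀ (x : Fin n) fl τ, At m H a x fl 0 τ → f τ ≤ ENNReal.ofReal (Φ 0 x fl))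
    (hΦ : ∀ c x fl, trialMean rank (ρ ^ (H - a)) x (Φ c x fl) (fun y => Φ c y 1) ≤
      Φ (c + 1) x fl)
    {x : Fin n} {fl c : ℕ} {σ : State} (hσ : At m H a x fl c σ) :
    ert rank err 0 block f σ ≤ ENNReal.ofReal (Φ m x 0) := by
  have := ert_block_le (rank := rank) h (f := f) le_rfl (fun _ => 0) (fun _ => le_rfl)
    (fun x fl c σ hσ => ?_) Φ hΦ₀ (by simpa using hf) (by simpa using hΦ) hσ
  · simpa using this
  · have := ert_trial_le (rank := rank) h (f := fun _ => 0) (B := 0) (A := fun _ => 0) le_rfl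
      (fun _ => le_rfl) (by simp) (by simp) hσ
    simpa [trialMean] using this

theorem trialMean_le {δ : ℝ} {x : Fin n} {B R : ℝ} {A : Fin n → ℝ} (Z : Fin n → ℝ)
    (h₁ : ∀ y, rank y < rank x → A y ≤ Z y ∧ (A y + B) / 2 ≤ Z y)
    (h₂ : ∀ y, ¬ rank y < rank x → B ≤ Z y ∧ B + δ * (A y - B) ≤ Z y)
    (hZ : ∑ y, Z y ≤ n * R) : trialMean rank δ x B A ≤ R := by
  have hn : (0 : ℝ) < n := by exact_mod_cast x.pos
  rw [trialMean, div_le_iff₀ hn, mul_comm]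
  refine le_trans (Finset.sum_le_sum fun y _ => ?_) hZ
  split_ifs with hy
  exacts [max_le (h₁ y hy).1 (h₁ y hy).2, max_le (h₂ y hy).1 (h₂ y hy).2]

/-- A champion that is not one of the `k` smallest elements survives a whole block only with
probability `(1 - k / (2 n)) ^ m`, as each trial replaces it with probability at least
`k / (2 n)`. -/
theorem ert_block_survive_le (h : Params err p ρ m H a) {k : ℕ} (hk : k ≤ n) {f : State → ℝ≥0∞}
    (hf : ∀ (x : Fin n) fl τ, At m H a x fl 0 τ → f τ ≤ if fl = 0 ∧ k ≤ rank x then 1 else 0)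
    {x : Fin n} {fl c : ℕ} {σ : State} (hσ : At m H a x fl c σ) :
    ert rank err 0 block f σ ≤ ENNReal.ofReal ((1 - k / (2 * n)) ^ m) := by
  have hn : (0 : ℝ) < n := by exact_mod_cast x.pos
  have hkn : (k : ℝ) ≤ n := by exact_mod_cast hk
  set g : ℝ := 1 - k / (2 * n) with hg
  have hg0 : 0 ≤ g := by
    rw [hg, sub_nonneg, div_le_one (by positivity)]; linarith
  refine (ert_block_prob_le h (fun c x fl => if fl = 0 ∧ k ≤ rank x then g ^ c else 0)
    (fun c x fl => by split_ifs <;> positivity) (fun x fl τ hτ => ?_) (fun c x fl => ?_) hσ).trans ?_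
  · refine (hf x fl τ hτ).trans ?_
    split_ifs <;> simp
  · have hgc : 0 ≤ g ^ c := by positivity
    by_cases hx : fl = 0 ∧ k ≤ rank x
    · refine trialMean_le (fun y => if (rank y : ℕ) < k then g ^ c / 2 else g ^ c)
        (fun y hy => ?_) (fun y hy => ?_) ?_
      · rw [if_neg (by simp), if_pos hx]
        split_ifs <;> constructor <;> linarith
      · have hyx : (rank x : ℕ) ≤ rank y := by simpa using hy
        have hρ := pow_pos h.pos (H - a)
        rw [if_pos hx, if_neg (show ¬ (1 = 0 ∧ k ≤ (rank y : ℕ)) by simp), if_neg (by omega)]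
        constructor
        · rfl
        · nlinarith
      · rw [sum_ite_rank_lt hk, if_pos hx, pow_succ]
        apply le_of_eq
        rw [hg]
        field_simp
        ring
    · rw [if_neg hx, if_neg hx]
      exact trialMean_le (fun _ => 0) (by simp) (by simp) (by simp)
  · split_ifs
    · rfl
    · simp

/-- A champion among the `s` smallest elements is likely to survive a block. -/
theorem ert_block_replace_le (h : Params err p ρ m H a) {s : ℕ} (hs : 0 < s) (hsn : s ≤ n)
    {f : State → ℝ≥0∞} (hf : ∀ (x : Fin n) fl τ, At m H a x fl 0 τ → f τ ≤ if fl = 0 then 0 else 1)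
    {x : Fin n} (hx : (rank x : ℕ) < s) {fl c : ℕ} {σ : State} (hσ : At m H a x fl c σ) :
    ert rank err 0 block f σ ≤ ENNReal.ofReal (m * ((s - 1) / n + ρ ^ (H - a))) := by
  have hn : (0 : ℝ) < n := by exact_mod_cast x.pos
  have hδ := pow_pos h.pos (H - a)
  set δ := ρ ^ (H - a)
  have hs1 : (1 : ℝ) ≤ s := by exact_mod_cast hs
  have hθ : 0 ≤ ((s : ℝ) - 1) / n + δ := by
    have : 0 ≤ (s : ℝ) - 1 := by linarith
    positivity
  set θ := ((s : ℝ) - 1) / n + δ with hθd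
  refine (ert_block_prob_le h
    (fun c x fl => if fl = 0 ∧ (rank x : ℕ) < s then c * θ else 1)
    (fun c x fl => by split_ifs <;> positivity) (fun x fl τ hτ => ?_) (fun c x fl => ?_) hσ).trans ?_
  · refine (hf x fl τ hτ).trans ?_
    split_ifs <;> simp_all
  · by_cases hx : fl = 0 ∧ (rank x : ℕ) < s
    · have hcθ : 0 ≤ c * θ := by positivity
      refine trialMean_le
        (fun y => c * θ + δ + if (rank y : ℕ) < (s - 1 : ℕ) then 1 else 0)
        (fun y hy => ?_) (fun y hy => ?_) ?_
      · rw [if_neg (by simp), if_pos hx, if_pos (by have : (rank y : ℕ) < rank x := hy; omega)]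
        constructor <;> linarith
      · rw [if_pos hx, if_neg (show ¬ (1 = 0 ∧ (rank y : ℕ) < s) by simp)]
        split_ifs <;> constructor <;> nlinarith
      · rw [Finset.sum_add_distrib, sum_ite_rank_lt (by omega), if_pos hx]
        simp only [Finset.sum_const, Finset.card_univ, Fintype.card_fin, nsmul_eq_mul]
        push_cast [Nat.cast_sub (show 1 ≤ s from hs)]
        apply le_of_eq
        have : (n : ℝ) * ((c + 1) * θ) = n * (c * θ) + n * (((s : ℝ) - 1) / n) + n * δ := by
          rw [hθd]; ring
        rw [this, mul_div_cancel₀ _ hn.ne']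
        ring
    · rw [if_neg hx, if_neg hx]
      refine trialMean_le (fun _ => 1) ?_ ?_ (by simp) <;> simp
  · split_ifs with h'
    · rfl
    · exact absurd ⟨rfl, hx⟩ h'

/-- A block replaces any champion by one of the `s` smallest elements with probability almost
`1 - (1 - s / (2 n)) ^ m`. -/
theorem ert_block_improve_le (h : Params err p ρ m H a) {s : ℕ} (hsn : s ≤ n)
    {f : State → ℝ≥0∞}
    (hf : ∀ (x : Fin n) fl τ, At m H a x fl 0 τ → f τ ≤ if (rank x : ℕ) < s then 0 else 1)
    {x : Fin n} {fl c : ℕ} {σ : State} (hσ : At m H a x fl c σ) :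
    ert rank err 0 block f σ ≤
      ENNReal.ofReal ((1 - s / (2 * n)) ^ m + m * ρ ^ (H - a)) := by
  have hn : (0 : ℝ) < n := by exact_mod_cast x.pos
  have hδ := pow_pos h.pos (H - a)
  set δ := ρ ^ (H - a)
  have hsn' : (s : ℝ) ≤ n := by exact_mod_cast hsn
  set g : ℝ := 1 - s / (2 * n) with hg
  have hg0 : 0 ≤ g := by
    rw [hg, sub_nonneg, div_le_one (by positivity)]; linarith
  have hg1 : g ≤ 1 := by
    rw [hg]; have : 0 ≤ (s : ℝ) / (2 * n) := by positivity
    linarith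
  refine (ert_block_prob_le h
    (fun c x fl => (if (rank x : ℕ) < s then 0 else g ^ c) + c * δ)
    (fun c x fl => by split_ifs <;> positivity) (fun x fl τ hτ => ?_) (fun c x fl => ?_) hσ).trans ?_
  · refine (hf x fl τ hτ).trans ?_
    split_ifs <;> simp
  · have hgc : 0 ≤ g ^ c := by positivity
    have hgc1 : g ^ c ≤ 1 := pow_le_one₀ hg0 hg1
    by_cases hx : (rank x : ℕ) < s
    · refine trialMean_le (fun y => (c + 1) * δ) (fun y hy => ?_) (fun y hy => ?_) ?_
      · have : (rank y : ℕ) < rank x := hy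
        rw [if_pos hx, if_pos (by omega)]
        constructor <;> linarith
      · rw [if_pos hx]
        split_ifs <;> constructor <;> nlinarith
      · rw [if_pos hx]
        simp
    · refine trialMean_le (fun y => c * δ + if (rank y : ℕ) < s then g ^ c / 2 else g ^ c)
        (fun y hy => ?_) (fun y hy => ?_) ?_
      · rw [if_neg hx]
        split_ifs <;> constructor <;> linarith
      · have hyx : (rank x : ℕ) ≤ rank y := by simpa using hy
        have hy' : ¬ (rank y : ℕ) < s := by omega
        simp only [if_neg hx, if_neg hy']
        constructor <;> linarith
      · rw [Finset.sum_add_distrib, sum_ite_rank_lt hsn, if_neg hx]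
        simp only [Finset.sum_const, Finset.card_univ, Fintype.card_fin, nsmul_eq_mul]
        have : (n : ℝ) * g ^ (c + 1) = s * (g ^ c / 2) + (n - s) * g ^ c := by
          rw [pow_succ]
          nth_rewrite 2 [hg]
          field_simp
          ring
        push_cast
        rw [mul_add, this]
        nlinarith [mul_pos hn hδ]
  · refine ENNReal.ofReal_le_ofReal ?_
    split_ifs
    · have : 0 ≤ g ^ m := by positivity
      linarith
    · rfl

theorem sum_range_half (c : ℝ) (l : ℕ) :
    ∑ j ∈ Finset.range l, ((j : ℝ) + c) / 2 = l * (l - 1) / 4 + l * c / 2 := by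
  induction l with
  | zero => simp
  | succ l ih => rw [Finset.sum_range_succ, ih]; push_cast; ring

theorem sum_ite_rank_half (x : Fin n) :
    ∑ y, (if (rank y : ℕ) < rank x then ((rank y : ℝ) + rank x) / 2 else (rank x : ℝ)) ≤
      n * (rank x : ℕ) - (rank x : ℝ) ^ 2 / 4 := by
  have hx : (rank x : ℕ) ≤ n := (rank x).2.le
  generalize (rank x : ℕ) = R at hx ⊢
  rw [Equiv.sum_comp rank fun j => if (j : ℕ) < R then ((j : ℝ) + R) / 2 else (R : ℝ),
    Fin.sum_univ_eq_sum_range (fun j => if j < R then ((j : ℝ) + R) / 2 else (R : ℝ))]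
  obtain ⟨l, hl⟩ := Nat.exists_eq_add_of_le hx
  rw [hl, Finset.sum_range_add,
    Finset.sum_congr rfl fun j hj => if_pos (Finset.mem_range.1 hj),
    Finset.sum_congr rfl fun j _ => if_neg (by omega : ¬ R + j < R), sum_range_half]
  simp only [Finset.sum_const, Finset.card_range, nsmul_eq_mul]
  push_cast
  nlinarith [(Nat.cast_nonneg R : (0 : ℝ) ≤ R)]

/-- The expected time of a block is `O(m + H ^ 2)`.  A duel takes time `O(H)` only if the challenger
is smaller than the champion; the potential `H ^ 2 * rank x / n` pays for these duels, since such a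
challenger is likely to lower it. -/
theorem ert_block_time_le (h : Params err p ρ m H a) {f : State → ℝ≥0∞}
    (hf : ∀ (x : Fin n) fl τ, At m H a x fl 0 τ → f τ ≤ 2) {x : Fin n} {fl c : ℕ} {σ : State}
    (hσ : At m H a x fl c σ) {K : ℝ} (hK : 5 + 12 / (1 - 2 * p) * a = K) :
    ert rank err 1 block f σ ≤ ENNReal.ofReal (7 + 5 * K * H ^ 2 + m * (3 + 2 * K)) := by
  have hn : (0 : ℝ) < n := by exact_mod_cast x.pos
  have hδ := pow_pos h.pos (H - a)
  have hmδ := h.trials_mul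
  set δ := ρ ^ (H - a)
  have hK0 : 0 < K := by
    have := h.lt_half
    have : 0 < 12 / (1 - 2 * p) := div_pos (by norm_num) (by linarith)
    rw [← hK]; positivity
  set D := 3 + 2 * K + 4 * K * H ^ 2 * δ with hD
  have hD0 : 0 < D := by positivity
  have := ert_block_le (rank := rank) (β := 1) h zero_le_one (f := f)
    (fun x => K * (1 + rank x / n * H)) (fun x => by positivity)
    (fun x fl c σ hσ => by rw [← hK, ENNReal.ofReal_one]; exact ert_trial_time_le h hσ)
    (fun c x fl => 4 * K * H ^ 2 * (rank x / n) + c * D + 3) (fun c x fl => by positivity)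
    (fun x fl τ hτ => ?_) (fun c x fl => ?_) hσ
  · rw [ENNReal.ofReal_one] at this
    refine this.trans (ENNReal.ofReal_le_ofReal ?_)
    have hr : (rank x : ℝ) / n ≤ 1 := by
      rw [div_le_one hn]; exact_mod_cast (rank x).2.le
    have e1 : 4 * K * H ^ 2 * ((rank x : ℝ) / n) ≤ 4 * K * H ^ 2 * 1 := by gcongr
    have e2 : 4 * K * (H : ℝ) ^ 2 * (m * δ) ≤ 4 * K * H ^ 2 * (1 / 32) := by gcongr
    have e3 : 0 ≤ K * (H : ℝ) ^ 2 := by positivity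
    rw [hD]
    nlinarith
  · calc _ ≤ ENNReal.ofReal 1 + 2 := by gcongr; exact hf x fl τ hτ
      _ = ENNReal.ofReal 3 := by
        rw [ENNReal.ofReal_one, ENNReal.ofReal_ofNat]; norm_num
      _ ≤ _ := by
        refine ENNReal.ofReal_le_ofReal ?_
        have : 0 ≤ 4 * K * (H : ℝ) ^ 2 * (rank x / n) := by positivity
        simp only [Nat.cast_zero, zero_mul, add_zero]
        linarith
  · set r : ℝ := rank x / n with hr
    have hr0 : 0 ≤ r := by positivity
    set α := 4 * K * (H : ℝ) ^ 2 with hα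
    have hα0 : 0 ≤ α := by positivity
    have key : trialMean rank δ x (α * r + c * D + 3) (fun y => α * (rank y / n) + c * D + 3) ≤
        α * (r - r ^ 2 / 4) + α * δ + c * D + 3 := by
      refine trialMean_le (fun y => α / n * (if (rank y : ℕ) < rank x then
        ((rank y : ℝ) + rank x) / 2 else (rank x : ℝ)) + (α * δ + c * D + 3))
        (fun y hy => ?_) (fun y hy => ?_) ?_
      · have hy' : (rank y : ℕ) < rank x := hy
        have hy'' : (rank y : ℝ) ≤ rank x := by exact_mod_cast hy'.le
        rw [if_pos hy', hr]
        have e1 : α / n * ((rank y : ℝ) + rank x) / 2 =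
          (α * (rank y / n) + α * (rank x / n)) / 2 := by ring
        have e2 : α * ((rank y : ℝ) / n) ≤ α * (rank x / n) := by gcongr
        have e3 : 0 ≤ α * δ := by positivity
        constructor <;> linarith
      · have hy' : ¬ (rank y : ℕ) < rank x := hy
        rw [if_neg hy', hr]
        have e1 : α / n * (rank x : ℝ) = α * (rank x / n) := by ring
        have e3 : 0 ≤ α * δ := by positivity
        have e4 : (rank y : ℝ) / n ≤ 1 := by
          rw [div_le_one hn]; exact_mod_cast (rank y).2.le
        have e5 : α * δ * ((rank y : ℝ) / n) ≤ α * δ * 1 := by gcongr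
        have e6 : 0 ≤ α * δ * ((rank x : ℝ) / n) := by positivity
        constructor
        · linarith
        · nlinarith
      · rw [Finset.sum_add_distrib, ← Finset.mul_sum]
        simp only [Finset.sum_const, Finset.card_univ, Fintype.card_fin, nsmul_eq_mul]
        have := mul_le_mul_of_nonneg_left (sum_ite_rank_half (rank := rank) x)
          (show 0 ≤ α / n by positivity)
        have e1 : α / n * (n * rank x - (rank x : ℝ) ^ 2 / 4) = n * (α * (r - r ^ 2 / 4)) := by
          rw [hr]; field_simp
        rw [e1] at this
        linarith
    refine (add_le_add_right key _).trans ?_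
    push_cast
    rw [hD]
    have e1 : K * (r * H) ≤ K * (1 + r ^ 2 * H ^ 2) := by
      gcongr
      nlinarith [sq_nonneg (r * H - 1), mul_nonneg hr0 (Nat.cast_nonneg H : (0 : ℝ) ≤ H)]
    have e2 : α * (r ^ 2 / 4) = K * (r ^ 2 * H ^ 2) := by rw [hα]; ring
    nlinarith

/-! ### Repeating blocks -/

theorem one_sub_pow_le {u : ℝ} (hu : 0 ≤ u) (hu₁ : u ≤ 1) {m : ℕ} (hmu : 1 / 8 ≤ m * u) :
    (1 - u) ^ m ≤ 8 / 9 := by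
  have h1 : 1 + (m : ℝ) * u ≤ (1 + u) ^ m := one_add_mul_le_pow (by linarith) m
  have h2 : (1 - u) ^ m * (1 + u) ^ m ≤ 1 := by
    rw [← mul_pow]
    exact pow_le_one₀ (by nlinarith) (by nlinarith)
  have h3 : 0 ≤ (1 - u) ^ m := pow_nonneg (by linarith) m
  nlinarith

open Classical in
/-- The rule for the repetition of blocks: if one block, and the end of the search if it comes right
after it, have expected cost at most `Λ`, then the search has expected cost at most `38 * Λ`.

Call the champion strong if it is one of the `s` smallest elements, for `s` about `n / (4 m)`.  A
strong champion survives a block with probability at least `1 / 2`, and any champion is replaced by a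
strong one with probability at least `1 / 18`; so `20 * Λ` and `38 * Λ` are bounds for strong and for
other champions.  The value `∞` in the hypothesis concerns states that a block cannot end in. -/
theorem ert_repeat_block_le (h : Params err p ρ m H a) (hn : 2 ≤ n) {b Λ : ℝ≥0∞} (hΛ₀ : Λ ≠ 0)
    (hΛ : Λ ≠ ∞) {f : State → ℝ≥0∞}
    (hf : ∀ (x : Fin n) fl c σ, At m H a x fl c σ → b + ert rank err b block
      (fun τ => if ∃ (y : Fin n) (fl' : ℕ), At m H a y fl' 0 τ then
        (if τ.reg 8 = 0 then b + f τ else 0) else ∞) σ ≤ Λ)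
    {x : Fin n} {fl c : ℕ} {σ : State} (hσ : At m H a x fl c σ) (hfl : fl ≠ 0) :
    ert rank err b (.whileLt 2 8 block) f σ ≤ 38 * Λ := by
  have hn' : (0 : ℝ) < n := by exact_mod_cast x.pos
  have hm : (0 : ℝ) < m := by exact_mod_cast h.trials_pos
  set s := n / (4 * m) + 1 with hs
  have hsn : s ≤ n := by
    have h1 : n / (4 * m) ≤ n / 4 :=
      Nat.div_le_div_left (by have := h.trials_pos; omega) (by norm_num)
    omega
  have hs1 : ((s : ℝ) - 1) ≤ n / (4 * m) := by
    have := @Nat.cast_div_le ℝ _ _ _ n (4 * m)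
    rw [hs]; push_cast at this ⊢; linarith
  have hs2 : (n : ℝ) / (4 * m) ≤ s := by
    have h1 : n < (n / (4 * m) + 1) * (4 * m) := by
      have := Nat.lt_mul_div_succ n (show 0 < 4 * m by have := h.trials_pos; omega)
      linarith
    rw [div_le_iff₀ (by positivity)]
    exact_mod_cast h1.le
  have hδ := h.trials_mul
  -- The expected cost after a block is split into the cost `g₁` of ending the search at once and
  -- multiples of the probabilities that the search goes on (`g₂`) and that the champion is not
  -- strong (`g₃`).
  let g₁ : State → ℝ≥0∞ := fun τ => if ∃ (y : Fin n) (fl' : ℕ), At m H a y fl' 0 τ then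
        (if τ.reg 8 = 0 then b + f τ else 0) else ∞
  let g₂ : State → ℝ≥0∞ := fun τ => if τ.reg 8 = 0 then 0 else 1
  let g₃ : State → ℝ≥0∞ := fun τ => if ∃ y : Fin n, τ.reg 7 = y ∧ (rank y : ℕ) < s then 0 else 1
  have hg₂ : ∀ {x : Fin n} {fl c σ}, At m H a x fl c σ → (rank x : ℕ) < s →
      ert rank err 0 block g₂ σ ≤ 2⁻¹ := by
    intro x fl c σ hσ hx
    refine (ert_block_replace_le h (Nat.succ_pos _) hsn (fun y fl τ hτ => ?_) hx hσ).trans ?_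
    · simp only [g₂, hτ.flag]; exact le_rfl
    · rw [← ENNReal.ofReal_ofNat, ← ENNReal.ofReal_inv_of_pos (by norm_num)]
      refine ENNReal.ofReal_le_ofReal ?_
      have e1 : (m : ℝ) * (((s : ℝ) - 1) / n) ≤ m * (n / (4 * m) / n) := by gcongr
      have e2 : (m : ℝ) * (n / (4 * m) / n) = 1 / 4 := by field_simp
      rw [mul_add]
      linarith
  have hg₃ : ∀ {x : Fin n} {fl c σ}, At m H a x fl c σ →
      ert rank err 0 block g₃ σ ≤ ENNReal.ofReal (17 / 18) := by
    intro x fl c σ hσ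
    refine (ert_block_improve_le h hsn (fun y fl τ hτ => ?_) hσ).trans ?_
    · simp only [g₃]
      split_ifs with h1 h2 h2
      · exact le_rfl
      · exact zero_le
      · exact absurd ⟨y, hτ.champion, h2⟩ h1
      · exact le_rfl
    · refine ENNReal.ofReal_le_ofReal ?_
      have hsn' : (s : ℝ) ≤ n := by exact_mod_cast hsn
      have e1 : (1 - (s : ℝ) / (2 * n)) ^ m ≤ 8 / 9 := by
        refine one_sub_pow_le (by positivity) ?_ ?_
        · rw [div_le_one (by positivity)]; linarith
        · have : (m : ℝ) * (n / (4 * m) / (2 * n)) = 1 / 8 := by field_simp; norm_num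
          rw [← this]
          gcongr
      linarith
  let I : State → ℝ≥0∞ := fun τ =>
    ⨅ (x : Fin n) (fl : ℕ) (c : ℕ) (_ : At m H a x fl c τ),
      if fl = 0 then b + f τ else if (rank x : ℕ) < s then 20 * Λ else 38 * Λ
  have hIle : ∀ {x fl c τ}, At m H a x fl c τ → I τ ≤
      if fl = 0 then b + f τ else if (rank x : ℕ) < s then 20 * Λ else 38 * Λ :=
    fun {x fl c τ} hτ => iInf_le_of_le x (iInf_le_of_le fl (iInf_le_of_le c (iInf_le _ hτ)))
  have hI₂ : ∀ τ, I τ ≤ g₁ τ + 38 * Λ * g₂ τ := by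
    intro τ
    by_cases hτ : ∃ (y : Fin n) (fl' : ℕ), At m H a y fl' 0 τ
    swap
    · simp [g₁, hτ]
    obtain ⟨y, fl', hy⟩ := id hτ
    refine (hIle hy).trans ?_
    simp only [g₁, g₂, if_pos hτ, hy.flag]
    split_ifs
    · simp
    · rw [mul_one, zero_add]; gcongr; norm_num
    · simp
  have hI₃ : ∀ τ, I τ ≤ g₁ τ + (20 * Λ * 1 + 18 * Λ * g₃ τ) := by
    intro τ
    by_cases hτ : ∃ (y : Fin n) (fl' : ℕ), At m H a y fl' 0 τ
    swap
    · simp [g₁, hτ]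
    obtain ⟨y, fl', hy⟩ := id hτ
    refine (hIle hy).trans ?_
    simp only [g₁, g₃, if_pos hτ, hy.flag]
    by_cases h0 : fl' = 0
    · simp [h0]
    by_cases hys : (rank y : ℕ) < s
    · simp [h0, hys]
    · have : ¬ ∃ z : Fin n, τ.reg 7 = z ∧ (rank z : ℕ) < s := by
        rintro ⟨z, hz, hzs⟩
        rw [hy.champion] at hz
        exact hys (Fin.ext hz ▸ hzs)
      rw [if_neg h0, if_neg hys, if_neg h0, if_neg this]
      apply le_of_eq; ring
  have hone : ∀ {x : Fin n} {fl c σ}, At m H a x fl c σ →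
      ert rank err 0 block (fun _ => 1) σ ≤ 1 := by
    intro x fl c σ hσ
    refine (ert_block_prob_le h (fun _ _ _ => 1) (by simp) (by simp) (fun c x fl => ?_) hσ).trans
      (by simp)
    exact trialMean_le (fun _ => 1) (by simp) (by simp) (by simp)
  have hscale : ∀ (r : ℝ≥0∞) (g : State → ℝ≥0∞) (τ : State), r ≠ 0 → r ≠ ∞ →
      ert rank err 0 block (fun τ => r * Λ * g τ) τ ≤ r * Λ * ert rank err 0 block g τ := by
    intro r g τ h0 h1
    have := ert_smul (rank := rank) (err := err) (mul_ne_zero h0 hΛ₀) (ENNReal.mul_ne_top h1 hΛ) 0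
      block g τ
    rwa [mul_zero] at this
  refine (ert_while_le I (fun τ => ?_) σ).trans ((hIle hσ).trans ?_)
  swap
  · rw [if_neg hfl]
    split_ifs
    · gcongr; norm_num
    · exact le_rfl
  refine le_iInf fun x => le_iInf fun fl => le_iInf fun c => le_iInf fun hτ => ?_
  rw [hτ.zero, hτ.flag]
  by_cases h0 : fl = 0
  · simp [h0]
  rw [if_pos (Nat.pos_of_ne_zero h0), if_neg h0]
  split_ifs with hx
  · calc b + ert rank err b block I τ
        ≤ b + ert rank err (b + 0) block (fun τ => g₁ τ + 38 * Λ * g₂ τ) τ := by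
          rw [add_zero]; gcongr; exact ert_mono _ _ hI₂ τ
      _ ≤ b + (ert rank err b block g₁ τ + 38 * Λ * 2⁻¹) := by
          gcongr
          refine (ert_add _ _ _ _ _ τ).trans ?_
          gcongr
          exact (hscale 38 g₂ τ (by norm_num) (by norm_num)).trans (by gcongr; exact hg₂ hτ hx)
      _ ≤ Λ + 38 * Λ * 2⁻¹ := by
          rw [← add_assoc]; gcongr; exact hf x fl c τ hτ
      _ = 20 * Λ := by
          rw [mul_right_comm, show (38 : ℝ≥0∞) = 19 * 2 by norm_num, mul_assoc 19,
            ENNReal.mul_inv_cancel (by norm_num) (by norm_num)]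
          ring
  · calc b + ert rank err b block I τ
        ≤ b + ert rank err (b + (0 + 0)) block
            (fun τ => g₁ τ + (20 * Λ * 1 + 18 * Λ * g₃ τ)) τ := by
          rw [add_zero, add_zero]; gcongr; exact ert_mono _ _ hI₃ τ
      _ ≤ b + (ert rank err b block g₁ τ + (20 * Λ * 1 + 18 * Λ * ENNReal.ofReal (17 / 18))) := by
          gcongr
          refine (ert_add _ _ _ _ _ τ).trans ?_
          gcongr
          refine (ert_add _ _ _ _ _ τ).trans ?_
          gcongr
          · exact (hscale 20 _ τ (by norm_num) (by norm_num)).trans (by gcongr; exact hone hτ)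
          · exact (hscale 18 g₃ τ (by norm_num) (by norm_num)).trans (by gcongr; exact hg₃ hτ)
      _ ≤ Λ + (20 * Λ * 1 + 18 * Λ * ENNReal.ofReal (17 / 18)) := by
          rw [← add_assoc]; gcongr; exact hf x fl c τ hτ
      _ = 38 * Λ := by
          have : (18 : ℝ≥0∞) * ENNReal.ofReal (17 / 18) = 17 := by
            rw [← ENNReal.ofReal_ofNat, ← ENNReal.ofReal_mul (by norm_num)]; norm_num
          rw [mul_right_comm 18, this]; ring

open Classical in
/-- A wrong answer requires that a champion outside the `k` smallest elements survives a block. -/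
theorem ert_search_error_le (h : Params err p ρ m H a) (hn : 2 ≤ n) {k : ℕ} (hk : k ≤ n)
    {x : Fin n} {fl c : ℕ} {σ : State} (hσ : At m H a x fl c σ) (hfl : fl ≠ 0) :
    ert rank err 0 search
      (fun σ => if ∃ i : Fin n, σ.reg 0 = i ∧ (rank i : ℕ) < k then 0 else 1) σ ≤
      ENNReal.ofReal (38 * (1 - k / (2 * n)) ^ m) := by
  have hn' : (0 : ℝ) < n := by exact_mod_cast x.pos
  have hkn : (k : ℝ) ≤ n := by exact_mod_cast hk
  have hg : 0 < 1 - (k : ℝ) / (2 * n) := by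
    rw [sub_pos, div_lt_one (by positivity)]; linarith
  rw [search, ert, zero_add, ENNReal.ofReal_mul (by norm_num), ENNReal.ofReal_ofNat]
  refine ert_repeat_block_le h hn (by simpa using pow_pos hg m) ENNReal.ofReal_ne_top
    (fun x fl c σ hσ => ?_) hσ hfl
  rw [zero_add]
  refine ert_block_survive_le h hk (fun y fl τ hτ => ?_) hσ
  rw [if_pos ⟨y, fl, hτ⟩, hτ.flag]
  by_cases h0 : fl = 0
  · by_cases hy : k ≤ rank y
    · rw [if_pos h0, if_pos ⟨h0, hy⟩, zero_add, ert, zero_add]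
      split_ifs <;> simp
    · rw [if_pos h0, zero_add, ert, zero_add, if_pos]
      · exact zero_le
      · exact ⟨y, by simp [State.setReg, hτ.champion, hτ.zero], by omega⟩
  · simp [h0]

theorem ert_search_time_le (h : Params err p ρ m H a) (hn : 2 ≤ n)
    {x : Fin n} {fl c : ℕ} {σ : State} (hσ : At m H a x fl c σ) (hfl : fl ≠ 0) {K : ℝ}
    (hK : 5 + 12 / (1 - 2 * p) * a = K) :
    ert rank err 1 search (fun _ => 0) σ ≤
      ENNReal.ofReal (1 + 38 * (8 + 5 * K * H ^ 2 + m * (3 + 2 * K))) := by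
  have hK0 : 0 < K := by
    have := h.lt_half
    have : 0 < 12 / (1 - 2 * p) := div_pos (by norm_num) (by linarith)
    rw [← hK]; positivity
  have hpos : 0 < 8 + 5 * K * H ^ 2 + m * (3 + 2 * K) := by positivity
  rw [search, ert, ENNReal.ofReal_add (by norm_num) (by positivity), ENNReal.ofReal_one,
    ENNReal.ofReal_mul (by norm_num), ENNReal.ofReal_ofNat]
  gcongr
  refine ert_repeat_block_le h hn (by simpa using hpos) ENNReal.ofReal_ne_top
    (fun x fl c σ hσ => ?_) hσ hfl
  have e1 : 8 + 5 * K * (H : ℝ) ^ 2 + m * (3 + 2 * K) =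
    1 + (7 + 5 * K * (H : ℝ) ^ 2 + m * (3 + 2 * K)) := by ring
  rw [e1, ENNReal.ofReal_add (by norm_num) (by positivity), ENNReal.ofReal_one]
  gcongr
  refine ert_block_time_le h (fun y fl τ hτ => ?_) hσ hK
  rw [if_pos ⟨y, fl, hτ⟩]
  split_ifs
  · simp only [ert, add_zero]; norm_num
  · simp

/-! ### The whole program -/

/-- A rule for loops that run deterministically for `N` rounds: `Inv i` holds after `i` rounds. -/
theorem ert_while_count_le {b C : ℝ≥0∞} {r s : ℕ} {P : Prog} {f : State → ℝ≥0∞} {B : ℝ≥0∞}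
    (N : ℕ) (Inv : ℕ → State → Prop)
    (hstep : ∀ i < N, ∀ τ, Inv i τ → τ.reg r < τ.reg s ∧
      ∃ τ', Inv (i + 1) τ' ∧ ∀ f : State → ℝ≥0∞, ert rank err b P f τ ≤ C * b + f τ')
    (hend : ∀ τ, Inv N τ → ¬ τ.reg r < τ.reg s) (hf : ∀ τ, Inv N τ → f τ ≤ B)
    {σ : State} (hσ : Inv 0 σ) :
    ert rank err b (.whileLt r s P) f σ ≤ (N * (C + 1) + 1) * b + B := by
  let I : State → ℝ≥0∞ := fun τ =>
    ⨅ (i : ℕ) (j : ℕ) (_ : i + j = N ∧ Inv i τ), ((j * (C + 1) + 1) * b + B)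
  have hIle : ∀ {i j τ}, i + j = N → Inv i τ → I τ ≤ (j * (C + 1) + 1) * b + B :=
    fun {i j τ} h1 h2 => iInf_le_of_le i (iInf_le_of_le j (iInf_le _ ⟨h1, h2⟩))
  refine (ert_while_le I (fun τ => ?_) σ).trans (hIle (zero_add N) hσ)
  refine le_iInf fun i => le_iInf fun j => le_iInf fun ⟨hij, hτ⟩ => ?_
  rcases j with _ | j
  · obtain rfl : i = N := hij
    rw [if_neg (hend τ hτ)]
    simpa using add_le_add_right (hf τ hτ) b
  · obtain ⟨h1, τ', h2, h3⟩ := hstep i (by omega) τ hτ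
    rw [if_pos h1]
    calc b + ert rank err b P I τ ≤ b + (C * b + ((j * (C + 1) + 1) * b + B)) := by
          gcongr
          exact (h3 I).trans (by gcongr; exact hIle (by omega) h2)
      _ = _ := by push_cast; ring

/-- The whole program.  With `L = ⌈log₂ n⌉`, the first loop computes `n * L`, the second one the
number `m = 14 * ⌈n * L / k⌉` of trials in a block, and the third one the height
`6 * a + a * ⌈log₂ m⌉` at which a duel is won. -/
def program (a : ℕ) : Prog :=
  .seq (.const 3 1) (.seq (.const 10 1)
  (.seq (.whileLt 10 0 (.seq (.add 10 10 10) (.add 11 11 0)))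
  (.seq (.const 13 14)
  (.seq (.whileLt 12 11 (.seq (.add 12 12 1) (.add 4 4 13)))
  (.seq (.const 10 1) (.seq (.const 14 a) (.seq (.const 5 (6 * a))
  (.seq (.whileLt 10 4 (.seq (.add 10 10 10) (.add 5 5 14)))
  (.seq (.const 6 a) (.seq (.const 8 1) search))))))))))

/-- The number of trials in a block. -/
def blockLength (n k : ℕ) : ℕ := 14 * ((n * Nat.clog 2 n) ⌈/⌉ k)

/-- The height at which a duel is won. -/
def winHeight (a m : ℕ) : ℕ := 6 * a + a * Nat.clog 2 m

theorem ert_program_le (hn : 0 < n) {k : ℕ} (hk : 0 < k) (a : ℕ) {b : ℝ≥0∞} {f : State → ℝ≥0∞}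
    {B : ℝ≥0∞}
    (hB : ∀ σ, At (blockLength n k) (winHeight a (blockLength n k)) a (⟨0, hn⟩ : Fin n) 1 0 σ →
      ert rank err b search f σ ≤ B) :
    ert rank err b (program a) f (init (program a) n k).state ≤
      (22 + 4 * Nat.clog 2 n + 4 * ((n * Nat.clog 2 n) ⌈/⌉ k : ℕ) +
        4 * Nat.clog 2 (blockLength n k)) * b + B := by
  set L := Nat.clog 2 n with hL
  set q := (n * L) ⌈/⌉ k with hq
  set m := blockLength n k with hm
  let Inv₁ : ℕ → State → Prop := fun i τ => τ.reg 0 = n ∧ τ.reg 1 = k ∧ τ.reg 2 = 0 ∧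
    τ.reg 3 = 1 ∧ τ.reg 4 = 0 ∧ τ.reg 7 = 0 ∧ τ.reg 9 = 0 ∧ τ.reg 10 = 2 ^ i ∧ τ.reg 11 = n * i ∧
    τ.reg 12 = 0
  let Inv₂ : ℕ → State → Prop := fun j τ => τ.reg 0 = n ∧ τ.reg 1 = k ∧ τ.reg 2 = 0 ∧
    τ.reg 3 = 1 ∧ τ.reg 4 = 14 * j ∧ τ.reg 7 = 0 ∧ τ.reg 9 = 0 ∧ τ.reg 11 = n * L ∧
    τ.reg 12 = k * j ∧ τ.reg 13 = 14
  let Inv₃ : ℕ → State → Prop := fun i τ => τ.reg 0 = n ∧ τ.reg 2 = 0 ∧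
    τ.reg 3 = 1 ∧ τ.reg 4 = m ∧ τ.reg 5 = 6 * a + a * i ∧ τ.reg 7 = 0 ∧ τ.reg 9 = 0 ∧
    τ.reg 10 = 2 ^ i ∧ τ.reg 14 = a
  have h₃ : ∀ τ, Inv₃ (Nat.clog 2 m) τ →
      ert rank err b (.seq (.const 6 a) (.seq (.const 8 1) search)) f τ ≤ 4 * b + B := by
    rintro τ ⟨h0, h2, h3, h4, h5, h7, h9, h10, h14⟩
    simp only [ert]
    have := hB ((τ.setReg 6 a).setReg 8 1) (by
      refine ⟨?_, ?_, ?_, ?_, ?_, ?_, ?_, ?_, ?_⟩ <;>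
        simp [State.setReg, Function.update, winHeight, *])
    calc _ ≤ b + (b + (b + (b + B))) := by gcongr
      _ = _ := by ring
  have hloop₃ : ∀ τ, Inv₃ 0 τ → ert rank err b
      (.whileLt 10 4 (.seq (.add 10 10 10) (.add 5 5 14)))
      (ert rank err b (.seq (.const 6 a) (.seq (.const 8 1) search)) f) τ ≤
        (Nat.clog 2 m * (3 + 1) + 1) * b + (4 * b + B) := by
    intro τ hτ
    refine ert_while_count_le _ Inv₃ ?_ ?_ h₃ hτ
    · rintro i hi τ ⟨h0, h2, h3, h4, h5, h7, h9, h10, h14⟩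
      have hlt : 2 ^ i < m := (Nat.lt_clog_iff_pow_lt (by norm_num)).1 hi
      refine ⟨by rw [h10, h4]; exact hlt,
        (τ.setReg 10 (2 ^ i + 2 ^ i)).setReg 5 (6 * a + a * i + a), ?_, fun g => ?_⟩
      · refine ⟨?_, ?_, ?_, ?_, ?_, ?_, ?_, ?_, ?_⟩ <;>
          simp [State.setReg, Function.update, *] <;> ring
      · simp only [ert]
        apply le_of_eq
        simp [State.setReg, Function.update, *]
        ring
    · rintro τ ⟨h0, h2, h3, h4, h5, h7, h9, h10, h14⟩
      rw [h10, h4, not_lt]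
      exact Nat.le_pow_clog (by norm_num) m
  have h₂ : ∀ τ, Inv₂ q τ → ert rank err b
      (.seq (.const 10 1) (.seq (.const 14 a) (.seq (.const 5 (6 * a))
      (.seq (.whileLt 10 4 (.seq (.add 10 10 10) (.add 5 5 14)))
      (.seq (.const 6 a) (.seq (.const 8 1) search)))))) f τ ≤
        7 * b + ((Nat.clog 2 m * (3 + 1) + 1) * b + (4 * b + B)) := by
    rintro τ ⟨h0, h1, h2, h3, h4, h7, h9, h11, h12, h13⟩
    have := hloop₃ (((τ.setReg 10 1).setReg 14 a).setReg 5 (6 * a)) (by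
      refine ⟨?_, ?_, ?_, ?_, ?_, ?_, ?_, ?_, ?_⟩ <;>
        simp [State.setReg, Function.update, *] <;> rfl)
    rw [ert, ert, ert, ert, ert, ert, ert]
    calc _ ≤ b + (b + (b + (b + (b + (b + (b +
        ((Nat.clog 2 m * (3 + 1) + 1) * b + (4 * b + B)))))))) := by gcongr
      _ = _ := by ring
  have hloop₂ : ∀ τ, Inv₂ 0 τ → ert rank err b
      (.whileLt 12 11 (.seq (.add 12 12 1) (.add 4 4 13)))
      (ert rank err b (.seq (.const 10 1) (.seq (.const 14 a) (.seq (.const 5 (6 * a))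
      (.seq (.whileLt 10 4 (.seq (.add 10 10 10) (.add 5 5 14)))
      (.seq (.const 6 a) (.seq (.const 8 1) search)))))) f) τ ≤
        (q * (3 + 1) + 1) * b + (7 * b + ((Nat.clog 2 m * (3 + 1) + 1) * b + (4 * b + B))) := by
    intro τ hτ
    refine ert_while_count_le _ Inv₂ ?_ ?_ h₂ hτ
    · rintro j hj τ ⟨h0, h1, h2, h3, h4, h7, h9, h11, h12, h13⟩
      have hlt : k * j < n * L := by
        by_contra hle
        have : q ≤ j := by
          rw [hq, ceilDiv_le_iff_le_mul hk]
          exact not_lt.1 hle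
        omega
      refine ⟨by rw [h12, h11]; exact hlt,
        (τ.setReg 12 (k * j + k)).setReg 4 (14 * j + 14), ?_, fun g => ?_⟩
      · refine ⟨?_, ?_, ?_, ?_, ?_, ?_, ?_, ?_, ?_, ?_⟩ <;>
          simp [State.setReg, Function.update, *] <;> ring
      · simp only [ert]
        apply le_of_eq
        simp [State.setReg, Function.update, *]
        ring
    · rintro τ ⟨h0, h1, h2, h3, h4, h7, h9, h11, h12, h13⟩
      rw [h12, h11, not_lt, ← ceilDiv_le_iff_le_mul hk]
  have h₁ : ∀ τ, Inv₁ L τ → ert rank err b (.seq (.const 13 14)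
      (.seq (.whileLt 12 11 (.seq (.add 12 12 1) (.add 4 4 13)))
      (.seq (.const 10 1) (.seq (.const 14 a) (.seq (.const 5 (6 * a))
      (.seq (.whileLt 10 4 (.seq (.add 10 10 10) (.add 5 5 14)))
      (.seq (.const 6 a) (.seq (.const 8 1) search)))))))) f τ ≤ 3 * b +
        ((q * (3 + 1) + 1) * b +
          (7 * b + ((Nat.clog 2 m * (3 + 1) + 1) * b + (4 * b + B)))) := by
    rintro τ ⟨h0, h1, h2, h3, h4, h7, h9, h10, h11, h12⟩
    have := hloop₂ (τ.setReg 13 14) (by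
      refine ⟨?_, ?_, ?_, ?_, ?_, ?_, ?_, ?_, ?_, ?_⟩ <;> simp [State.setReg, Function.update, *])
    rw [ert, ert, ert]
    calc _ ≤ b + (b + (b + ((q * (3 + 1) + 1) * b +
          (7 * b + ((Nat.clog 2 m * (3 + 1) + 1) * b + (4 * b + B)))))) := by gcongr
      _ = _ := by ring
  have hloop₁ : ∀ τ, Inv₁ 0 τ → ert rank err b
      (.whileLt 10 0 (.seq (.add 10 10 10) (.add 11 11 0)))
      (ert rank err b (.seq (.const 13 14)
      (.seq (.whileLt 12 11 (.seq (.add 12 12 1) (.add 4 4 13)))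
      (.seq (.const 10 1) (.seq (.const 14 a) (.seq (.const 5 (6 * a))
      (.seq (.whileLt 10 4 (.seq (.add 10 10 10) (.add 5 5 14)))
      (.seq (.const 6 a) (.seq (.const 8 1) search)))))))) f) τ ≤ (L * (3 + 1) + 1) * b +
        (3 * b + ((q * (3 + 1) + 1) * b +
          (7 * b + ((Nat.clog 2 m * (3 + 1) + 1) * b + (4 * b + B))))) := by
    intro τ hτ
    refine ert_while_count_le _ Inv₁ ?_ ?_ h₁ hτ
    · rintro i hi τ ⟨h0, h1, h2, h3, h4, h7, h9, h10, h11, h12⟩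
      have hlt : 2 ^ i < n := (Nat.lt_clog_iff_pow_lt (by norm_num)).1 hi
      refine ⟨by rw [h10, h0]; exact hlt,
        (τ.setReg 10 (2 ^ i + 2 ^ i)).setReg 11 (n * i + n), ?_, fun g => ?_⟩
      · refine ⟨?_, ?_, ?_, ?_, ?_, ?_, ?_, ?_, ?_, ?_⟩ <;>
          simp [State.setReg, Function.update, *] <;> ring
      · simp only [ert]
        apply le_of_eq
        simp [State.setReg, Function.update, *]
        ring
    · rintro τ ⟨h0, h1, h2, h3, h4, h7, h9, h10, h11, h12⟩
      rw [h10, h0, not_lt]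
      exact Nat.le_pow_clog (by norm_num) n
  have := hloop₁ (((init (program a) n k).state.setReg 3 1).setReg 10 1) (by
    refine ⟨?_, ?_, ?_, ?_, ?_, ?_, ?_, ?_, ?_, ?_⟩ <;> simp [State.setReg, Function.update, init])
  rw [program, ert, ert, ert, ert, ert]
  rw [program] at this
  calc _ ≤ b + (b + (b + (b + (b + ((L * (3 + 1) + 1) * b +
        (3 * b + ((q * (3 + 1) + 1) * b +
          (7 * b + ((Nat.clog 2 m * (3 + 1) + 1) * b + (4 * b + B)))))))))) := by gcongr
    _ = _ := by ring

/-! ### The choice of the parameters -/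

theorem pow_clog_lt_two_mul {m : ℕ} (hm : 0 < m) : 2 ^ Nat.clog 2 m < 2 * m := by
  rcases Nat.eq_or_lt_of_le (show 1 ≤ m from hm) with rfl | h1
  · simp
  · have h2 : 0 < Nat.clog 2 m := Nat.clog_pos (by norm_num) h1
    have h3 : 2 ^ (Nat.clog 2 m - 1) < m := (Nat.lt_clog_iff_pow_lt (by norm_num)).1 (by omega)
    obtain ⟨l, hl⟩ : ∃ l, Nat.clog 2 m = l + 1 := ⟨Nat.clog 2 m - 1, by omega⟩
    rw [hl] at h3 ⊢
    rw [pow_succ]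
    simp only [add_tsub_cancel_right] at h3
    omega

theorem add_six_sq_le (l : ℕ) : (6 + l) ^ 2 ≤ 36 * 2 ^ l := by
  induction l with
  | zero => norm_num
  | succ l ih =>
    calc (6 + (l + 1)) ^ 2 ≤ 2 * (6 + l) ^ 2 := by nlinarith [Nat.zero_le l, Nat.zero_le (l ^ 2)]
      _ ≤ 36 * 2 ^ (l + 1) := by rw [pow_succ 2 l]; omega

theorem add_six_clog_sq_le {m : ℕ} (hm : 0 < m) : (6 + Nat.clog 2 m) ^ 2 ≤ 72 * m := by
  have h1 := add_six_sq_le (Nat.clog 2 m)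
  have h2 := pow_clog_lt_two_mul hm
  omega

/-- For every fault probability below one half, suitable constants `ρ` and `a` exist. -/
theorem exists_params {p : ℝ} (hp : p < 1 / 2) :
    ∃ (ρ : ℝ) (a : ℕ), ∀ {n : ℕ} (err : ℕ → Fin n → Fin n → unitInterval),
      (∀ m i j, (err m i j : ℝ) ≤ p) → ∀ m, 0 < m → Params err p ρ m (winHeight a m) a := by
  have h1p : 0 < 1 - p := by linarith
  -- `ρ` is the mean of `p / (1 - p)` and `1`, the zeros of `(1 - p) * ρ ^ 2 - ρ + p`.
  set ρ : ℝ := 1 / (2 * (1 - p)) with hρ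
  have hρ₀ : 0 < ρ := by positivity
  have hρ₁ : ρ < 1 := by rw [hρ, div_lt_one (by positivity)]; linarith
  obtain ⟨a, ha⟩ := exists_pow_lt_of_lt_one (show (0 : ℝ) < 1 / 2 by norm_num) hρ₁
  have ha0 : 0 < a := by
    rcases Nat.eq_zero_or_pos a with rfl | h
    · norm_num at ha
    · exact h
  refine ⟨ρ, a, fun {n} err herr m hm => ⟨hp, herr, hρ₀, hρ₁, ?_, ha0, ?_, ha.le, hm, ?_⟩⟩
  · have e1 : ρ * (1 - p) = 1 / 2 := by rw [hρ]; field_simp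
    have e2 : (1 - p) * ρ ^ 2 = ρ / 2 := by
      rw [show (1 - p) * ρ ^ 2 = ρ * (ρ * (1 - p)) by ring, e1]; ring
    -- As `ρ * (1 - p) = 1 / 2`, the claim is `2 * p ≤ ρ`, that is `4 * p * (1 - p) ≤ 1`.
    have e3 : 2 * p ≤ ρ := by
      rw [hρ, le_div_iff₀ (by positivity)]
      nlinarith [sq_nonneg (1 - 2 * p)]
    linarith
  · have : 0 ≤ a * Nat.clog 2 m := Nat.zero_le _
    rw [winHeight]; omega
  · have e1 : winHeight a m - a = a * (5 + Nat.clog 2 m) := by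
      rw [winHeight, mul_add]; omega
    have e2 : (m : ℝ) ≤ 2 ^ Nat.clog 2 m := by exact_mod_cast Nat.le_pow_clog (by norm_num) m
    rw [e1, pow_mul]
    calc (m : ℝ) * (ρ ^ a) ^ (5 + Nat.clog 2 m)
        ≤ 2 ^ Nat.clog 2 m * (1 / 2) ^ (5 + Nat.clog 2 m) := by gcongr
      _ = (2 * (1 / 2)) ^ Nat.clog 2 m * (1 / 2) ^ 5 := by rw [mul_pow, pow_add]; ring
      _ = 1 / 32 := by norm_num

theorem clog_le_two_mul_logb {n : ℕ} (hn : 2 ≤ n) : (Nat.clog 2 n : ℝ) ≤ 2 * Real.logb 2 n := by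
  have hn' : (0 : ℝ) < n := by positivity
  have h1 : 1 ≤ Real.logb 2 n := by
    rw [Real.le_logb_iff_rpow_le (by norm_num) hn', Real.rpow_one]
    exact_mod_cast hn
  have h2 : (Nat.clog 2 n : ℝ) - 1 ≤ Real.logb 2 n := by
    rw [Real.le_logb_iff_rpow_le (by norm_num) hn', Real.rpow_sub_one (by norm_num),
      Real.rpow_natCast, div_le_iff₀ (by norm_num), mul_comm]
    exact_mod_cast (pow_clog_lt_two_mul (by omega : 0 < n)).le
  linarith

theorem le_blockLength {n k : ℕ} (hk : 0 < k) :
    14 * (n * Nat.clog 2 n) ≤ k * blockLength n k := by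
  have := (ceilDiv_le_iff_le_mul hk).1 (le_refl ((n * Nat.clog 2 n) ⌈/⌉ k))
  rw [blockLength]
  linarith

theorem blockLength_pos {n k : ℕ} (hn : 2 ≤ n) (hk : 0 < k) : 0 < blockLength n k := by
  have h1 := le_blockLength (n := n) hk
  have h2 : 0 < n * Nat.clog 2 n := Nat.mul_pos (by omega) (Nat.clog_pos (by norm_num) hn)
  exact Nat.pos_of_ne_zero fun h => by rw [h] at h1; omega

theorem ceilDiv_le_mul_logb {n k : ℕ} (hn : 2 ≤ n) (hk : 0 < k) (hkn : k ≤ n) :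
    (((n * Nat.clog 2 n) ⌈/⌉ k : ℕ) : ℝ) ≤ 4 * ((n : ℝ) / k * Real.logb 2 n) := by
  have hL : 0 < Nat.clog 2 n := Nat.clog_pos (by norm_num) hn
  have hk' : (0 : ℝ) < k := by exact_mod_cast hk
  set q := (n * Nat.clog 2 n) ⌈/⌉ k with hq
  have h1 : k * q ≤ 2 * (n * Nat.clog 2 n) := by
    rcases Nat.eq_zero_or_pos q with h0 | h0
    · rw [h0]; omega
    have h2 : k * (q - 1) < n * Nat.clog 2 n := by
      by_contra hle
      have : q ≤ q - 1 := by
        nth_rewrite 1 [hq]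
        rw [ceilDiv_le_iff_le_mul hk]
        exact not_lt.1 hle
      omega
    have h3 : k * (q - 1) + k = k * q := by
      rw [← Nat.mul_succ]; congr 1; omega
    have h4 : n * 1 ≤ n * Nat.clog 2 n := Nat.mul_le_mul_left n hL
    omega
  have h2 : (k : ℝ) * q ≤ 2 * (n * Nat.clog 2 n) := by exact_mod_cast h1
  have h3 := clog_le_two_mul_logb hn
  rw [show 4 * ((n : ℝ) / k * Real.logb 2 n) = 4 * (n * Real.logb 2 n) / k by ring,
    le_div_iff₀ hk']
  nlinarith [(Nat.cast_nonneg n : (0 : ℝ) ≤ n)]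

/-- The error probability of a block is small enough for the whole search. -/
theorem one_sub_pow_blockLength_le {n k : ℕ} (hn : 2 ≤ n) (hk : 0 < k) (hkn : k ≤ n) :
    38 * (1 - (k : ℝ) / (2 * n)) ^ blockLength n k ≤ 1 / n := by
  have hn' : (0 : ℝ) < n := by positivity
  have hkn' : (k : ℝ) ≤ n := by exact_mod_cast hkn
  set L := Nat.clog 2 n with hL
  have hL0 : 0 < L := Nat.clog_pos (by norm_num) hn
  have hm : 14 * ((n : ℝ) * L) ≤ k * blockLength n k := by exact_mod_cast le_blockLength hk
  set m := blockLength n k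
  have h1 : 0 ≤ 1 - (k : ℝ) / (2 * n) := by
    rw [sub_nonneg, div_le_one (by positivity)]; linarith
  -- As `m` is at least `14 * n * L / k`, the exponent `k * m / (2 * n)` is at least `7 * L`: one `L`
  -- yields the factor `1 / n`, and the others outweigh the factor `38`.
  have h2 : (1 - (k : ℝ) / (2 * n)) ^ m ≤ Real.exp (-1) ^ (7 * L) := by
    calc (1 - (k : ℝ) / (2 * n)) ^ m ≤ Real.exp (-((k : ℝ) / (2 * n))) ^ m := by
          gcongr
          exact Real.one_sub_le_exp_neg _
      _ ≤ Real.exp (-1) ^ (7 * L) := by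
          rw [← Real.exp_nat_mul, ← Real.exp_nat_mul]
          refine Real.exp_le_exp.2 ?_
          have : (7 : ℝ) * L ≤ m * (k / (2 * n)) := by
            rw [← mul_div_assoc, le_div_iff₀ (by positivity)]
            linarith
          push_cast
          linarith
  have h3 : Real.exp (-1) ≤ 1 / 2 := by
    rw [Real.exp_neg, inv_eq_one_div]
    have := Real.add_one_le_exp (1 : ℝ)
    gcongr
    linarith
  have h4 : (n : ℝ) ≤ 2 ^ L := by exact_mod_cast Nat.le_pow_clog (by norm_num) n
  calc 38 * (1 - (k : ℝ) / (2 * n)) ^ m ≤ 38 * (1 / 2) ^ (7 * L) := by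
        gcongr
        exact h2.trans (by gcongr)
    _ = 38 * ((1 / 2) ^ 6) ^ L * (1 / 2 ^ L) := by
        rw [show 7 * L = 6 * L + L by ring, pow_add, pow_mul, one_div_pow 2 L]; ring
    _ ≤ 38 * ((1 / 2) ^ 6) ^ 1 * (1 / n) := by
        have : (((1 : ℝ) / 2) ^ 6) ^ L ≤ ((1 / 2) ^ 6) ^ 1 :=
          pow_le_pow_of_le_one (by norm_num) (by norm_num) hL0
        gcongr
    _ ≤ 1 * (1 / n) := by gcongr; norm_num
    _ = 1 / n := one_mul _

end FTMin

end

open FTMin in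
/-- For every bound `p < 1/2` on the probability of a comparison fault there is a single program `A`
that, given `n` and `k`, returns w.h.p. one of the `k` smallest of `n` elements, in expected time
`O((n / k) log n + (log n) log log log n)`.  The true order of the elements is given by `rank`
(element `i` is smaller than exactly those `j` with `rank i < rank j`), and `err` are the fault
probabilities of the individual comparisons. -/
theorem theorem19 (p : ℝ) (hp₀ : 0 ≤ p) (hp : p < 1 / 2) :
    ∃ (A : FTMin.Prog) (C : ℝ), ∀ n k : ℕ, 2 ≤ n → 1 ≤ k → k ≤ n →
      ∀ (rank : Equiv.Perm (Fin n)) (err : ℕ → Fin n → Fin n → unitInterval),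
        (∀ m i j, (err m i j : ℝ) ≤ p) →
          ENNReal.ofReal (1 - 1 / (n : ℝ)) ≤ FTMin.successProb rank err A k ∧
          FTMin.expectedTime rank err A k ≤
            ENNReal.ofReal (C * ((n : ℝ) / (k : ℝ) * Real.logb 2 n +
              Real.logb 2 n * max 0 (Real.logb 2 (Real.logb 2 (Real.logb 2 n))))) := by
  obtain ⟨ρ, a, hpar⟩ := exists_params hp
  set K : ℝ := 5 + 12 / (1 - 2 * p) * a with hK
  have hK0 : 0 < K := by
    have : 0 < 12 / (1 - 2 * p) := div_pos (by norm_num) (by linarith)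
    positivity
  refine ⟨program a, 20000 + 2128 * (360 * K * a ^ 2 + 3 + 2 * K), ?_⟩
  intro n k hn hk hkn rank err herr
  have hn0 : 0 < n := by omega
  set m := blockLength n k with hm
  have hm0 : 0 < m := blockLength_pos hn hk
  have h := hpar err herr m hm0
  have htime : expectedTime rank err (program a) k ≤ ENNReal.ofReal
      ((20000 + 2128 * (360 * K * a ^ 2 + 3 + 2 * K)) * ((n : ℝ) / (k : ℝ) * Real.logb 2 n +
        Real.logb 2 n * max 0 (Real.logb 2 (Real.logb 2 (Real.logb 2 n))))) := by
    refine (expectedTime_le_ert _ k).trans ((ert_program_le hn0 hk a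
      fun σ hσ => ert_search_time_le h hn hσ one_ne_zero rfl).trans ?_)
    rw [← hm, ← hK]
    set q := (n * Nat.clog 2 n) ⌈/⌉ k with hq
    set H := winHeight a m with hH
    have hcast : ((22 + 4 * Nat.clog 2 n + 4 * q + 4 * Nat.clog 2 m) * 1 : ℝ≥0∞) =
        ENNReal.ofReal (22 + 4 * Nat.clog 2 n + 4 * q + 4 * Nat.clog 2 m) := by
      rw [mul_one, show (22 + 4 * Nat.clog 2 n + 4 * q + 4 * Nat.clog 2 m : ℝ) =
        ((22 + 4 * Nat.clog 2 n + 4 * q + 4 * Nat.clog 2 m : ℕ) : ℝ) by push_cast; rfl,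
        ENNReal.ofReal_natCast]
      push_cast; rfl
    rw [hcast, ← ENNReal.ofReal_add (by positivity) (by positivity)]
    refine ENNReal.ofReal_le_ofReal ?_
    set Y : ℝ := (n : ℝ) / k * Real.logb 2 n with hY
    have hk' : (0 : ℝ) < k := by exact_mod_cast hk
    have hlog : 1 ≤ Real.logb 2 n := by
      rw [Real.le_logb_iff_rpow_le (by norm_num) (by positivity), Real.rpow_one]
      exact_mod_cast hn
    have hnk : 1 ≤ (n : ℝ) / k := by
      rw [one_le_div hk']; exact_mod_cast hkn
    have hYlog : Real.logb 2 n ≤ Y := by rw [hY]; nlinarith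
    have hqY : (q : ℝ) ≤ 4 * Y := ceilDiv_le_mul_logb hn hk hkn
    have hmq : (m : ℝ) = 14 * q := by rw [hm, blockLength]; push_cast; rfl
    have hLY : (Nat.clog 2 n : ℝ) ≤ 2 * Y := (clog_le_two_mul_logb hn).trans (by linarith)
    have hsq : (6 + (Nat.clog 2 m : ℝ)) ^ 2 ≤ 72 * m := by
      exact_mod_cast add_six_clog_sq_le hm0
    have hl : (Nat.clog 2 m : ℝ) ≤ 72 * m := by
      have : (0 : ℝ) ≤ Nat.clog 2 m := Nat.cast_nonneg _
      nlinarith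
    have hH2 : (H : ℝ) ^ 2 ≤ a ^ 2 * (72 * m) := by
      have : (H : ℝ) = a * (6 + Nat.clog 2 m) := by rw [hH, winHeight]; push_cast; ring
      rw [this, mul_pow]
      gcongr
    have hKH : 5 * K * (H : ℝ) ^ 2 ≤ 5 * K * (a ^ 2 * (72 * m)) := by gcongr
    set c := 360 * K * (a : ℝ) ^ 2 + 3 + 2 * K with hc
    have hc0 : 0 < c := by positivity
    have hcm : c * m ≤ c * (56 * Y) := by gcongr; linarith
    have hYY : Y ≤ Y + Real.logb 2 n * max 0 (Real.logb 2 (Real.logb 2 (Real.logb 2 n))) :=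
      le_add_of_nonneg_right (mul_nonneg (by linarith) (le_max_left _ _))
    calc _ ≤ 22 + 4 * (2 * Y) + 4 * (4 * Y) + 4 * (72 * m) + (1 + 38 * (8 + c * m)) := by
          have : c * m = 5 * K * (a ^ 2 * (72 * m)) + m * (3 + 2 * K) := by rw [hc]; ring
          rw [this]
          linarith
      _ ≤ (20000 + 2128 * c) * Y := by nlinarith
      _ ≤ _ := by gcongr
  refine ⟨?_, htime⟩
  have herror := (one_le_successProb_add_ert (rank := rank) (err := err) (program a) k
    (htime.trans_lt ENNReal.ofReal_lt_top).ne).trans (add_le_add_right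
      ((ert_program_le hn0 hk a fun σ hσ => (ert_search_error_le h hn hkn hσ one_ne_zero).trans
        (ENNReal.ofReal_le_ofReal (one_sub_pow_blockLength_le hn hk hkn)))) _)
  rw [mul_zero, zero_add] at herror
  rw [ENNReal.ofReal_sub _ (by positivity), ENNReal.ofReal_one]
  exact tsub_le_iff_right.2 herror
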